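/- For a permutation $\pi\in S_n$ let $d(\pi)=\#\{1\le i\le n-1:\pi(i)>\pi(i+1)\}$ be its number of descents. For a partition $\lambda\vdash n$ let $\mathcal C_\lambda\subseteq S_n$ be the conjugacy class of permutations of cycle type $\lambda$, let $m_1$ be the number of parts of $\lambda$ equal to $1$ (the number of fixed points), and put $\alpha_\lambda=m_1/n$. Let $\pi$ be uniformly distributed on $\mathcal C_\lambda$, define the normalized descent number $W_\lambda$ by $$d(\pi)=\frac{n+1}{2}-\frac{m_1^2}{2n}+\sqrt n\,W_\lambda ,$$ and let $M_\lambda(s)=\mathbb E[e^{sW_\lambda}]$ be its moment generating function. Then there exists a function $C:\mathbb R\to(0,\infty)$ such that $$\left|M_\lambda(s)-\exp\left\{\frac{s^2}{24}\left(1-4\alpha_\lambda^3+3\alpha_\lambda^4\right)\right\}\right|\le C(s)\,\frac{(\log n)^3}{\sqrt n}$$ for every integer $n\ge 2$, every $\lambda\vdash n$ and every $s\in\mathbb R$. -/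

import Mathlib

namespace ConjDescents

/-- The descent set of a permutation `π` of `{0, …, n-1}`: the positions `i` that have a
successor `i + 1` and satisfy `π i > π (i + 1)`. -/
def descentSet {n : ℕ} (π : Equiv.Perm (Fin n)) : Finset (Fin n) :=
  {i : Fin n | ∃ h : (i : ℕ) + 1 < n, π ⟨(i : ℕ) + 1, h⟩ < π i}

/-- The descent number `d(π)`. -/
def descentNumber {n : ℕ} (π : Equiv.Perm (Fin n)) : ℕ := (descentSet π).card

/-- The conjugacy class `𝒞_lam` of the permutations in `S_n` whose cycle lengths (fixed points
counted as cycles of length one) are the parts of `lam`. -/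
def conjClass {n : ℕ} (lam : n.Partition) : Finset (Equiv.Perm (Fin n)) :=
  {π : Equiv.Perm (Fin n) | π.partition.parts = lam.parts}

/-- `m_i`, the number of parts of `lam` equal to `i`. -/
def mult {n : ℕ} (lam : n.Partition) (i : ℕ) : ℕ := lam.parts.count i

/-- All subsets of the finite set `S_n` are events. -/
instance permMeasurableSpace (n : ℕ) : MeasurableSpace (Equiv.Perm (Fin n)) := ⊤

/-- The law of a permutation drawn uniformly from `𝒞_lam`. -/
noncomputable def classLaw {n : ℕ} (lam : n.Partition) :
    MeasureTheory.Measure (Equiv.Perm (Fin n)) :=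
  ProbabilityTheory.uniformOn (conjClass lam : Set (Equiv.Perm (Fin n)))

/-- The normalized descent number `W_lam`, the solution of
`d(π) = (n + 1) / 2 - m₁ ^ 2 / (2 n) + √n * W_lam(π)`. -/
noncomputable def normalizedDescent {n : ℕ} (lam : n.Partition) (π : Equiv.Perm (Fin n)) : ℝ :=
  ((descentNumber π : ℝ) - (((n : ℝ) + 1) / 2 - (mult lam 1 : ℝ) ^ 2 / (2 * (n : ℝ))))
    / Real.sqrt (n : ℝ)

/-- The moment generating function `M_lam(s) = 𝔼[exp (s W_lam)]`. -/
noncomputable def descentMGF {n : ℕ} (lam : n.Partition) (s : ℝ) : ℝ :=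
  ProbabilityTheory.mgf (normalizedDescent lam) (classLaw lam) s

/-- `α_lam = m₁ / n`, the proportion of fixed points. -/
noncomputable def fixedRatio {n : ℕ} (lam : n.Partition) : ℝ := (mult lam 1 : ℝ) / (n : ℝ)

end ConjDescents

set_option linter.unusedSectionVars false
namespace ConjDescents
open Finset

/-! Write N for the number of points, m for the number of fixed points of a permutation c in the
class, and α = m/N. A compatible pair is a total order together with a weakly monotone colouring by
k colours, such that c preserves (or reverses) the order inside each colour class. Sorting by the
order identifies these pairs with a conjugate of c and a weakly increasing word that must increase
at the descents (or ascents) of that conjugate. Their number is therefore a sum of binomial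
coefficients in k and the descent numbers (`card_compatiblePairs_eq_sum_choose`). Summing against
t^k with t = exp(-τ) turns this into the moment generating function at -τ√N or +τ√N, according to
the orientation (`descentMGF_eq_tsum`).

For fixed k a pair is almost determined by its colouring: points are ordered by the colour sequences
along their orbits, lexicographically, with alternating signs in the reversing case. Only ties leave
freedom, and apart from ties between fixed points they are rare. The count is k^(N-m) times a rising
(or falling) factorial of length m, up to a factor 1 + O(τ) when k is at least of order N/τ. The
upper bound adds one cycle at a time (`card_compatiblePairs_le`); the lower bound builds the order
from colourings in which no two consecutive colours repeat as a pair (`le_card_compatiblePairs`).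

Dividing by the rising factorial of length N and expanding logarithms to second order gives
exp(`rate`) in x = kτ/N (`compatibleRatio_bounds`). This is averaged against a negative binomial law
concentrated near x = 1. The tangent line of `rate` at 1 merely changes the parameter of that law,
so its contribution is explicit. The concave defect is controlled by a second moment, and x < 1/2 by
an exponential bound (`weighted_sum_bounds`). In the exponent the terms of order √N cancel, and what
remains is Nτ²(1 - 4α³ + 3α⁴)/24 (`log_main_term`). With Nτ² = s² the error is O(τ) = O(1/√N),
better than the rate claimed. -/

/-! ### Compatible pairs and the rigidity of the order once the colouring is given. -/

/-- The relation `r` itself or its converse, according to the orientation `e`. -/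
def orient {V : Type*} (e : Bool) (r : V → V → Prop) (u v : V) : Prop :=
  if e then r u v else r v u

/-- A strict total order `r` on `A` together with a colouring `f` of `A` that is weakly monotone
for `r`, such that the permutation `c` preserves (`e = true`) or reverses (`e = false`) the order
of any two points of the same colour. -/
structure IsCompatible {V : Type*} {k : ℕ} [NeZero k] (e : Bool) (c : Equiv.Perm V) (A : Finset V)
    (r : V → V → Prop) (f : V → Fin k) : Prop where
  supp : ∀ {u v}, r u v → u ∈ A ∧ v ∈ A
  off : ∀ {v}, v ∉ A → f v = 0
  irrefl : ∀ u, ¬ r u u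
  trans : ∀ {u v w}, r u v → r v w → r u w
  total : ∀ {u v}, u ∈ A → v ∈ A → u ≠ v → r u v ∨ r v u
  mono : ∀ {u v}, u ∈ A → v ∈ A → f u < f v → r u v
  step : ∀ {u v}, u ∈ A → v ∈ A → f u = f v → (r u v ↔ orient e r (c u) (c v))

/-- Two points carry the same colour sequence along their `c`-orbits. -/
def SameWord {V : Type*} {k : ℕ} (c : Equiv.Perm V) (f : V → Fin k) (u v : V) : Prop :=
  ∀ j : ℕ, f ((c ^ j) u) = f ((c ^ j) v)

open Classical in
/-- All compatible pairs on `A` with `k` colours. -/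
noncomputable def compatiblePairs {V : Type*} [Fintype V] (e : Bool) (c : Equiv.Perm V)
    (k : ℕ) [NeZero k] (A : Finset V) : Finset ((V → V → Prop) × (V → Fin k)) :=
  {p | IsCompatible e c A p.1 p.2}

section

variable {V : Type*} {k : ℕ} {e : Bool} {c : Equiv.Perm V} {A : Finset V}
  {r r' : V → V → Prop} {f f' : V → Fin k}

lemma SameWord.symm {u v : V} (h : SameWord c f u v) : SameWord c f v u := fun j => (h j).symm

lemma SameWord.trans {u v w : V} (h : SameWord c f u v) (h' : SameWord c f v w) :
    SameWord c f u w := fun j => (h j).trans (h' j)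

lemma SameWord.pow {u v : V} (h : SameWord c f u v) (i : ℕ) :
    SameWord c f ((c ^ i) u) ((c ^ i) v) := fun j => by
  rw [← Equiv.Perm.mul_apply, ← Equiv.Perm.mul_apply, ← pow_add]; exact h _

lemma pow_apply_mem (hA : ∀ v, c v ∈ A ↔ v ∈ A) (j : ℕ) (v : V) : (c ^ j) v ∈ A ↔ v ∈ A := by
  induction j with
  | zero => simp
  | succ j ih => rw [pow_succ', Equiv.Perm.mul_apply, hA, ih]

variable [NeZero k]

namespace IsCompatible

lemma asymm (h : IsCompatible e c A r f) {u v : V} (huv : r u v) : ¬ r v u :=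
  fun hvu => h.irrefl u (h.trans huv hvu)

lemma not_iff_converse (h : IsCompatible e c A r f) {u v : V} (hu : u ∈ A) (hv : v ∈ A)
    (huv : u ≠ v) : ¬ r u v ↔ r v u :=
  ⟨fun h' => (h.total hu hv huv).resolve_left h', fun h' => h.asymm h'⟩

lemma restrict (h : IsCompatible e c A r f) {B : Finset V} [DecidablePred (· ∈ B)] (hBA : B ⊆ A)
    (hB : ∀ v, c v ∈ B ↔ v ∈ B) :
    IsCompatible e c B (fun u v => r u v ∧ u ∈ B ∧ v ∈ B) (fun v => if v ∈ B then f v else 0) where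
  supp h' := h'.2
  off h' := by simp [h']
  irrefl u h' := h.irrefl u h'.1
  trans h1 h2 := ⟨h.trans h1.1 h2.1, h1.2.1, h2.2.2⟩
  total hu hv huv := by simpa [hu, hv] using h.total (hBA hu) (hBA hv) huv
  mono hu hv hlt := by
    simp only [hu, hv, if_true] at hlt
    exact ⟨h.mono (hBA hu) (hBA hv) hlt, hu, hv⟩
  step {u v} hu hv heq := by
    simp only [hu, hv, if_true] at heq
    have := h.step (hBA hu) (hBA hv) heq
    cases e <;> simpa [orient, hu, hv, hB] using this

/-- Along equal words, the `(1 or 2)`-fold iterate of `c` preserves the order. -/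
lemma iff_iterate (h : IsCompatible e c A r f) (hA : ∀ v, c v ∈ A ↔ v ∈ A) {N : ℕ}
    (hN : e = true ∨ Even N) {u v : V} (hu : u ∈ A) (hv : v ∈ A) (hs : SameWord c f u v) :
    r u v ↔ r ((c ^ N) u) ((c ^ N) v) := by
  have one : ∀ j, r ((c ^ j) u) ((c ^ j) v) ↔
      orient e r ((c ^ (j + 1)) u) ((c ^ (j + 1)) v) := fun j => by
    rw [pow_succ', Equiv.Perm.mul_apply, Equiv.Perm.mul_apply]
    exact h.step ((pow_apply_mem hA j u).2 hu) ((pow_apply_mem hA j v).2 hv) (hs j)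
  have one' : ∀ j, r ((c ^ j) v) ((c ^ j) u) ↔
      orient e r ((c ^ (j + 1)) v) ((c ^ (j + 1)) u) := fun j => by
    rw [pow_succ', Equiv.Perm.mul_apply, Equiv.Perm.mul_apply]
    exact h.step ((pow_apply_mem hA j v).2 hv) ((pow_apply_mem hA j u).2 hu) (hs j).symm
  cases e with
  | true =>
    clear hN
    induction N with
    | zero => simp
    | succ N ih => exact ih.trans ((one N).trans (by simp [orient]))
  | false =>
    obtain ⟨i, rfl⟩ := hN.resolve_left (by simp)
    induction i with
    | zero => simp
    | succ i ih =>
      have h1 := one (i + i)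
      have h2 := one' (i + i + 1)
      simp only [orient, Bool.false_eq_true, if_false] at h1 h2
      rw [show i + 1 + (i + 1) = i + i + 1 + 1 by ring]
      exact (ih (Or.inr ⟨i, rfl⟩)).trans (h1.trans h2)

/-- Otherwise u and its image under `c ^ N` would be strictly ordered. Since `c ^ N` preserves order
along equal words, its iterates on u would form a strictly monotone chain, yet the chain returns to
u after `orderOf c` steps. -/
lemma pow_apply_eq_self [Finite V] (h : IsCompatible e c A r f) (hA : ∀ v, c v ∈ A ↔ v ∈ A) {N : ℕ}
    (hN : e = true ∨ Even N) {u : V} (hu : u ∈ A) (hs : SameWord c f u ((c ^ N) u)) :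
    (c ^ N) u = u := by
  by_contra hne
  have hword : ∀ a : ℕ, SameWord c f u ((c ^ (N * a)) u) := fun a => by
    induction a with
    | zero => intro j; simp
    | succ a ih =>
      refine hs.trans ?_
      have := ih.pow N
      rwa [← Equiv.Perm.mul_apply, ← pow_add, show N + N * a = N * (a + 1) by ring] at this
  have hmem : (c ^ N) u ∈ A := (pow_apply_mem hA N u).2 hu
  have hpar : ∀ a : ℕ, e = true ∨ Even (N * a) := fun a => hN.imp id (fun h => h.mul_right a)
  have hfin : (c ^ (N * orderOf c)) u = u := by
    rw [mul_comm, pow_mul, pow_orderOf_eq_one]; simp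
  have hpos : 0 < orderOf c := orderOf_pos c
  have shift : ∀ a, (c ^ (N * a)) ((c ^ N) u) = (c ^ (N * (a + 1))) u := fun a => by
    rw [← Equiv.Perm.mul_apply, ← pow_add]; congr 2
  rcases h.total hu hmem (Ne.symm hne) with h1 | h1
  · have chain : ∀ a, r u ((c ^ (N * (a + 1))) u) := fun a => by
      induction a with
      | zero => simpa using h1
      | succ a ih =>
        refine h.trans ih ?_
        have := (h.iff_iterate hA (hpar (a + 1)) hu hmem hs).1 h1
        rwa [shift] at this
    have := chain (orderOf c - 1)
    rw [Nat.sub_add_cancel hpos, hfin] at this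
    exact h.irrefl _ this
  · have chain : ∀ a, r ((c ^ (N * (a + 1))) u) u := fun a => by
      induction a with
      | zero => simpa using h1
      | succ a ih =>
        refine h.trans ?_ ih
        have := (h.iff_iterate hA (hpar (a + 1)) hmem hu hs.symm).1 h1
        rwa [shift] at this
    have := chain (orderOf c - 1)
    rw [Nat.sub_add_cancel hpos, hfin] at this
    exact h.irrefl _ this

/-- Two points of one orbit sharing their word with a third are determined up to one choice. -/
lemma eq_of_sameWord_orbit [Finite V] (h : IsCompatible e c A r f) (hA : ∀ v, c v ∈ A ↔ v ∈ A)
    {z v v' : V} (hz : z ∈ A) {q q' : ℕ} (hv : (c ^ q) z = v) (hv' : (c ^ q') z = v')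
    (hs : SameWord c f v z) (hs' : SameWord c f v' z) (hne : v ≠ z) (hne' : v' ≠ z) : v = v' := by
  subst hv hv'
  have key : ∀ a b : ℕ, a ≤ b → SameWord c f ((c ^ a) z) ((c ^ b) z) → (e = true ∨ Even (b - a)) →
      (c ^ a) z = (c ^ b) z := fun a b hab hw hpar => by
    have hb : (c ^ b) z = (c ^ (b - a)) ((c ^ a) z) := by
      rw [← Equiv.Perm.mul_apply, ← pow_add, Nat.sub_add_cancel hab]
    rw [hb] at hw ⊢
    exact (h.pow_apply_eq_self hA hpar ((pow_apply_mem hA a z).2 hz) hw).symm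
  by_cases he : e = true
  · exact absurd (h.pow_apply_eq_self hA (Or.inl he) hz hs.symm) hne
  -- Under reversal, a nontrivial return to the word of z takes an odd number of steps. Two such
  -- exponents differ by an even number, for which `pow_apply_eq_self` forbids distinct points.
  have hodd : ∀ {q}, SameWord c f ((c ^ q) z) z → (c ^ q) z ≠ z → Odd q := fun {q} hs hne => by
    by_contra hq
    exact hne (h.pow_apply_eq_self hA (Or.inr (Nat.not_odd_iff_even.1 hq)) hz hs.symm)
  have h1 := hodd hs hne
  have h2 := hodd hs' hne'
  rcases le_total q q' with hle | hle
  · exact key q q' hle (hs.trans hs'.symm) (Or.inr (Nat.Odd.sub_odd h2 h1))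
  · exact (key q' q hle (hs'.trans hs.symm) (Or.inr (Nat.Odd.sub_odd h1 h2))).symm

lemma agree_symm (h : IsCompatible e c A r f) (h' : IsCompatible e c A r' f) {u v : V}
    (hu : u ∈ A) (hv : v ∈ A) (ha : r u v ↔ r' u v) : r v u ↔ r' v u := by
  by_cases huv : u = v
  · subst huv; exact ha
  · rw [← h.not_iff_converse hu hv huv, ← h'.not_iff_converse hu hv huv, ha]

/-- Agreement is pulled back one step of c at a time: different colours fix the order by
monotonicity, and equal colours transfer the question to the images under c. -/
lemma agree_of_agree_pow (h : IsCompatible e c A r f) (h' : IsCompatible e c A r' f)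
    (hA : ∀ v, c v ∈ A ↔ v ∈ A) (j : ℕ) {u v : V} (hu : u ∈ A) (hv : v ∈ A)
    (ha : r ((c ^ j) u) ((c ^ j) v) ↔ r' ((c ^ j) u) ((c ^ j) v)) : r u v ↔ r' u v := by
  induction j generalizing u v with
  | zero => simpa using ha
  | succ j ih =>
    rcases lt_trichotomy (f u) (f v) with hlt | heq | hgt
    · exact ⟨fun _ => h'.mono hu hv hlt, fun _ => h.mono hu hv hlt⟩
    · rw [pow_succ, Equiv.Perm.mul_apply, Equiv.Perm.mul_apply] at ha
      have := ih ((hA u).2 hu) ((hA v).2 hv) ha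
      rw [h.step hu hv heq, h'.step hu hv heq]
      cases e with
      | true => simpa [orient] using this
      | false =>
        simpa [orient] using h.agree_symm h' ((hA u).2 hu) ((hA v).2 hv) this
    · exact ⟨fun h1 => absurd (h.mono hv hu hgt) (h.asymm h1),
        fun h1 => absurd (h'.mono hv hu hgt) (h'.asymm h1)⟩

lemma sameWord_of_disagree (h : IsCompatible e c A r f) (h' : IsCompatible e c A r' f)
    (hA : ∀ v, c v ∈ A ↔ v ∈ A) {u v : V} (hu : u ∈ A) (hv : v ∈ A)
    (ha : ¬ (r u v ↔ r' u v)) : SameWord c f u v := by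
  intro j
  by_contra hne
  apply ha
  have hu' := (pow_apply_mem hA j u).2 hu
  have hv' := (pow_apply_mem hA j v).2 hv
  refine h.agree_of_agree_pow h' hA j hu hv ?_
  rcases lt_or_gt_of_ne hne with hlt | hgt
  · exact ⟨fun _ => h'.mono hu' hv' hlt, fun _ => h.mono hu' hv' hlt⟩
  · exact ⟨fun h1 => absurd (h.mono hv' hu' hgt) (h.asymm h1),
      fun h1 => absurd (h'.mono hv' hu' hgt) (h'.asymm h1)⟩

/-- Compatible orders with one colouring are equal when they agree on pairs in `B` and on the pairs
formed by a point `z` of the remaining cycle and a point with the same word. -/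
lemma order_ext (h : IsCompatible e c A r f) (h' : IsCompatible e c A r' f)
    (hA : ∀ v, c v ∈ A ↔ v ∈ A) {B : Finset V} {z : V}
    (hz : ∀ v ∈ A, v ∉ B → ∃ j : ℕ, (c ^ j) v = z)
    (hB : ∀ u ∈ B, ∀ v ∈ B, (r u v ↔ r' u v))
    (hzv : ∀ v ∈ A, v ≠ z → SameWord c f v z → (r v z ↔ r' v z)) : r = r' := by
  funext u v
  refine propext ?_
  by_cases hu : u ∈ A
  swap
  · exact ⟨fun h1 => absurd (h.supp h1).1 hu, fun h1 => absurd (h'.supp h1).1 hu⟩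
  by_cases hv : v ∈ A
  swap
  · exact ⟨fun h1 => absurd (h.supp h1).2 hv, fun h1 => absurd (h'.supp h1).2 hv⟩
  -- A disagreement forces equal words. The power of c carrying v to z then moves the pair into the
  -- scope of `hzv`, and agreement there can be pulled back.
  have key : ∀ {u v}, u ∈ A → v ∈ A → v ∉ B → (r u v ↔ r' u v) := fun {u v} hu hv hvB => by
    by_contra ha
    have hs := h.sameWord_of_disagree h' hA hu hv ha
    obtain ⟨j, hj⟩ := hz v hv hvB
    apply ha
    refine h.agree_of_agree_pow h' hA j hu hv ?_
    have hs' := hs.pow j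
    rw [hj] at hs' ⊢
    by_cases heq : (c ^ j) u = z
    · rw [heq]; exact ⟨fun h1 => absurd h1 (h.irrefl _), fun h1 => absurd h1 (h'.irrefl _)⟩
    · exact hzv _ ((pow_apply_mem hA j u).2 hu) heq hs'
  by_cases hvB : v ∈ B
  · by_cases huB : u ∈ B
    · exact hB u huB v hvB
    · exact h.agree_symm h' hv hu (key hv hu huB)
  · exact key hu hv hvB

lemma exists_top [Finite V] (h : IsCompatible e c A r f) (S : Set V) (hS : S.Nonempty)
    (hSA : ∀ v ∈ S, v ∈ A) : ∃ m ∈ S, ∀ v ∈ S, v = m ∨ r v m := by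
  have : IsTrans V (fun a b => r b a) := ⟨fun _ _ _ h1 h2 => h.trans h2 h1⟩
  have : Std.Irrefl (fun a b => r b a) := ⟨fun a => h.irrefl a⟩
  have wf : WellFounded (fun a b => r b a) := Finite.wellFounded_of_trans_of_irrefl _
  obtain ⟨m, hm, hmin⟩ := wf.has_min S hS
  refine ⟨m, hm, fun v hv => ?_⟩
  by_cases hvm : v = m
  · exact Or.inl hvm
  · exact Or.inr ((h.total (hSA v hv) (hSA m hm) hvm).resolve_right (hmin v hv))

end IsCompatible

end

/-! ### Upper bound: extending compatible pairs by one cycle. -/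

lemma card_le_card_of_code {α X : Type*} [Fintype X] (s : Finset α) (P : α → X → Prop)
    (hex : ∀ p ∈ s, ∃ x, P p x) (hinj : ∀ p ∈ s, ∀ q ∈ s, ∀ x, P p x → P q x → p = q) :
    s.card ≤ Fintype.card X := by
  classical
  rcases s.eq_empty_or_nonempty with rfl | ⟨p₀, hp₀⟩
  · simp
  have : Nonempty X := ⟨(hex p₀ hp₀).choose⟩
  choose! g hg using hex
  rw [← Finset.card_univ]
  exact Finset.card_le_card_of_injOn g (fun _ _ => Finset.mem_coe.2 (Finset.mem_univ _))
    (fun p hp q hq h => hinj p hp q hq (g p) (hg p hp) (h ▸ hg q hq))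

section

variable {V : Type*} [Fintype V] [DecidableEq V] {k : ℕ} [NeZero k] {e : Bool}
  {c : Equiv.Perm V} {A Z : Finset V} {z : V}

/-- Restriction of an order and a colouring to `A`. -/
def restrictPair (A : Finset V) (p : (V → V → Prop) × (V → Fin k)) :
    (V → V → Prop) × (V → Fin k) :=
  (fun u v => p.1 u v ∧ u ∈ A ∧ v ∈ A, fun v => if v ∈ A then p.2 v else 0)

lemma mem_compatiblePairs {p : (V → V → Prop) × (V → Fin k)} :
    p ∈ compatiblePairs e c k A ↔ IsCompatible e c A p.1 p.2 := by
  simp [compatiblePairs]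

/-- `Z` is a cycle of `c` through `z`, disjoint from the invariant set `A`. -/
structure IsExtraCycle (c : Equiv.Perm V) (A Z : Finset V) (z : V) : Prop where
  inv : ∀ v, c v ∈ A ↔ v ∈ A
  inv' : ∀ v, c v ∈ Z ↔ v ∈ Z
  disj : Disjoint A Z
  mem : z ∈ Z
  toBase : ∀ v ∈ Z, ∃ j : ℕ, (c ^ j) v = z
  fromBase : ∀ v ∈ Z, ∃ j : ℕ, (c ^ j) z = v

lemma IsExtraCycle.inv_union (h : IsExtraCycle c A Z z) (v : V) : c v ∈ A ∪ Z ↔ v ∈ A ∪ Z := by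
  simp [h.inv, h.inv']

/-- Some point of the new cycle other than `z` has the word of `z` and lies below `z`. -/
def HasTwin (c : Equiv.Perm V) (Z : Finset V) (z : V) (p : (V → V → Prop) × (V → Fin k)) : Prop :=
  ∃ v ∈ Z, v ≠ z ∧ SameWord c p.2 v z ∧ p.1 v z

/-- `v` is the largest point of `A` below `z` that has the word of `z`. -/
def IsTop (c : Equiv.Perm V) (A : Finset V) (z : V) (p : (V → V → Prop) × (V → Fin k)) (v : V) :
    Prop :=
  v ∈ A ∧ SameWord c p.2 v z ∧ p.1 v z ∧
    ∀ w ∈ A, SameWord c p.2 w z → p.1 w z → w = v ∨ p.1 w v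

/-- No point of `A` below `z` has the word of `z`. -/
def NoneBelow (c : Equiv.Perm V) (A : Finset V) (z : V) (p : (V → V → Prop) × (V → Fin k)) : Prop :=
  ∀ w ∈ A, SameWord c p.2 w z → ¬ p.1 w z

lemma noneBelow_or_isTop {p : (V → V → Prop) × (V → Fin k)}
    (hp : IsCompatible e c (A ∪ Z) p.1 p.2) :
    NoneBelow c A z p ∨ ∃ v, IsTop c A z p v := by
  by_cases h : NoneBelow c A z p
  · exact Or.inl h
  · right
    have hne : {w : V | w ∈ A ∧ SameWord c p.2 w z ∧ p.1 w z}.Nonempty := by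
      simp only [NoneBelow, not_forall, not_not] at h
      obtain ⟨w, h1, h2, h3⟩ := h
      exact ⟨w, h1, h2, h3⟩
    obtain ⟨m, hm, hmax⟩ := hp.exists_top _ hne (fun v hv => Finset.mem_union_left _ hv.1)
    exact ⟨m, hm.1, hm.2.1, hm.2.2, fun w h1 h2 h3 => hmax w ⟨h1, h2, h3⟩⟩

section fiber

variable {p q : (V → V → Prop) × (V → Fin k)}

lemma rel_iff_of_restrictPair_eq (hpq : restrictPair A p = restrictPair A q) {u v : V} (hu : u ∈ A)
    (hv : v ∈ A) : p.1 u v ↔ q.1 u v := by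
  have := congrFun (congrFun (congrArg Prod.fst hpq) u) v
  simpa [restrictPair, hu, hv] using this

lemma color_eq_of_restrictPair_eq (hpq : restrictPair A p = restrictPair A q) {u : V}
    (hu : u ∈ A) : p.2 u = q.2 u := by
  have := congrFun (congrArg Prod.snd hpq) u
  simpa [restrictPair, hu] using this

lemma color_eq (hp : IsCompatible e c (A ∪ Z) p.1 p.2) (hq : IsCompatible e c (A ∪ Z) q.1 q.2)
    (hpq : restrictPair A p = restrictPair A q) (hZ : ∀ v ∈ Z, p.2 v = q.2 v) : p.2 = q.2 := by
  funext v
  by_cases hvA : v ∈ A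
  · exact color_eq_of_restrictPair_eq hpq hvA
  by_cases hvZ : v ∈ Z
  · exact hZ v hvZ
  · rw [hp.off (by simp [hvA, hvZ]), hq.off (by simp [hvA, hvZ])]

/-- The word of z is that of v, and the orbit of v stays in A, so the colours on the new cycle can
be read off from the restriction. -/
lemma color_eq_of_isTop (hc : IsExtraCycle c A Z z) (hpq : restrictPair A p = restrictPair A q)
    {v : V} (h1 : IsTop c A z p v) (h2 : IsTop c A z q v) : ∀ w ∈ Z, p.2 w = q.2 w := by
  intro w hw
  obtain ⟨j, rfl⟩ := hc.fromBase w hw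
  rw [← h1.2.1 j, ← h2.2.1 j]
  exact color_eq_of_restrictPair_eq hpq ((pow_apply_mem hc.inv j v).2 h1.1)

/-- By rigidity, all the freedom of an extension lies in the colours on Z, the position of z among
the points of A with its word, and one bit for the possible second point of Z with that word. -/
lemma pair_eq (hc : IsExtraCycle c A Z z) (hp : IsCompatible e c (A ∪ Z) p.1 p.2)
    (hq : IsCompatible e c (A ∪ Z) q.1 q.2) (hpq : restrictPair A p = restrictPair A q)
    (hZ : ∀ v ∈ Z, p.2 v = q.2 v) (htwin : HasTwin c Z z p ↔ HasTwin c Z z q)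
    (hA : ∀ v ∈ A, SameWord c p.2 v z → (p.1 v z ↔ q.1 v z)) : p = q := by
  have hf : p.2 = q.2 := color_eq hp hq hpq hZ
  refine Prod.ext ?_ hf
  have hq' : IsCompatible e c (A ∪ Z) q.1 p.2 := hf ▸ hq
  refine hp.order_ext hq' hc.inv_union (B := A) (z := z) ?_ ?_ ?_
  · intro v hv hvA
    exact hc.toBase v ((Finset.mem_union.1 hv).resolve_left hvA)
  · exact fun u hu v hv => rel_iff_of_restrictPair_eq hpq hu hv
  · intro v hv hvz hs
    rcases Finset.mem_union.1 hv with hvA | hvZ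
    · exact hA v hvA hs
    have hzB : z ∈ A ∪ Z := Finset.mem_union_right _ hc.mem
    -- At most one other point of the cycle shares the word of z, so `HasTwin` records exactly how
    -- it compares with z.
    have uniq : ∀ w ∈ Z, w ≠ z → SameWord c p.2 w z → w = v := fun w hw hwz hws => by
      obtain ⟨i, hi⟩ := hc.fromBase w hw
      obtain ⟨j, hj⟩ := hc.fromBase v hvZ
      exact hp.eq_of_sameWord_orbit hc.inv_union hzB hi hj hws hs hwz hvz
    have tw : ∀ {r : V → V → Prop}, HasTwin c Z z (r, p.2) ↔ r v z := fun {r} => by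
      constructor
      · rintro ⟨w, hw, hwz, hws, hr⟩
        rwa [uniq w hw hwz hws] at hr
      · exact fun hr => ⟨v, hvZ, hvz, hs, hr⟩
    have e1 : HasTwin c Z z p ↔ p.1 v z := tw
    have e2 : HasTwin c Z z q ↔ q.1 v z := by
      have : HasTwin c Z z (q.1, p.2) ↔ q.1 v z := tw
      rwa [hf] at this
    rw [← e1, ← e2, htwin]

lemma pair_eq_of_isTop (hc : IsExtraCycle c A Z z) (hp : IsCompatible e c (A ∪ Z) p.1 p.2)
    (hq : IsCompatible e c (A ∪ Z) q.1 q.2) (hpq : restrictPair A p = restrictPair A q)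
    (htwin : HasTwin c Z z p ↔ HasTwin c Z z q) {v : V} (h1 : IsTop c A z p v)
    (h2 : IsTop c A z q v) : p = q := by
  have hZ := color_eq_of_isTop hc hpq h1 h2
  have hf := color_eq hp hq hpq hZ
  refine pair_eq hc hp hq hpq hZ htwin fun w hw hs => ?_
  have hs' : SameWord c q.2 w z := hf ▸ hs
  have e1 : p.1 w z ↔ w = v ∨ p.1 w v :=
    ⟨h1.2.2.2 w hw hs, by rintro (rfl | h); exacts [h1.2.2.1, hp.trans h h1.2.2.1]⟩
  have e2 : q.1 w z ↔ w = v ∨ q.1 w v :=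
    ⟨h2.2.2.2 w hw hs', by rintro (rfl | h); exacts [h2.2.2.1, hq.trans h h2.2.2.1]⟩
  rw [e1, e2, rel_iff_of_restrictPair_eq hpq hw h1.1]

lemma pair_eq_of_noneBelow (hc : IsExtraCycle c A Z z) (hp : IsCompatible e c (A ∪ Z) p.1 p.2)
    (hq : IsCompatible e c (A ∪ Z) q.1 q.2) (hpq : restrictPair A p = restrictPair A q)
    (htwin : HasTwin c Z z p ↔ HasTwin c Z z q) (hZ : ∀ v ∈ Z, p.2 v = q.2 v)
    (h1 : NoneBelow c A z p) (h2 : NoneBelow c A z q) : p = q := by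
  have hf := color_eq hp hq hpq hZ
  exact pair_eq hc hp hq hpq hZ htwin fun w hw hs =>
    ⟨fun h => absurd h (h1 w hw hs), fun h => absurd h (h2 w hw (hf ▸ hs))⟩

end fiber

/-- Either z has no point of its word below it in A, and the colouring of Z is a complete code, or
the largest such point of A is a code by itself. -/
lemma card_fiber_no_twin (hc : IsExtraCycle c A Z z) (s : Finset ((V → V → Prop) × (V → Fin k)))
    (hs : ∀ p ∈ s, IsCompatible e c (A ∪ Z) p.1 p.2)
    (hres : ∀ p ∈ s, ∀ q ∈ s, restrictPair A p = restrictPair A q)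
    (htw : ∀ p ∈ s, ¬ HasTwin c Z z p) : s.card ≤ k ^ Z.card + A.card := by
  have := card_le_card_of_code (X := (Z → Fin k) ⊕ A) s (fun p x => match x with
    | Sum.inl g => NoneBelow c A z p ∧ ∀ v : Z, p.2 v = g v
    | Sum.inr v => IsTop c A z p v) ?_ ?_
  · simpa using this
  · intro p hp
    rcases noneBelow_or_isTop (z := z) (hs p hp) with h | ⟨v, hv⟩
    · exact ⟨Sum.inl fun v => p.2 v, h, fun _ => rfl⟩
    · exact ⟨Sum.inr ⟨v, hv.1⟩, hv⟩
  · intro p hp q hq x h1 h2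
    have ht : HasTwin c Z z p ↔ HasTwin c Z z q := iff_of_false (htw p hp) (htw q hq)
    rcases x with g | v
    · exact pair_eq_of_noneBelow hc (hs p hp) (hs q hq) (hres p hp q hq) ht
        (fun v hv => (h1.2 ⟨v, hv⟩).trans (h2.2 ⟨v, hv⟩).symm) h1.1 h2.1
    · exact pair_eq_of_isTop hc (hs p hp) (hs q hq) (hres p hp q hq) ht h1 h2

/-- Naming the twin costs a factor |Z|, but the colour of z is then the colour of the twin, which
saves a factor k. -/
lemma card_fiber_twin (hc : IsExtraCycle c A Z z) (s : Finset ((V → V → Prop) × (V → Fin k)))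
    (hs : ∀ p ∈ s, IsCompatible e c (A ∪ Z) p.1 p.2)
    (hres : ∀ p ∈ s, ∀ q ∈ s, restrictPair A p = restrictPair A q)
    (htw : ∀ p ∈ s, HasTwin c Z z p) : s.card ≤ Z.card * k ^ (Z.card - 1) + A.card := by
  have := card_le_card_of_code (X := (Z × (Z.erase z → Fin k)) ⊕ A) s (fun p x => match x with
    | Sum.inl g => NoneBelow c A z p ∧ (g.1 : V) ≠ z ∧ p.2 g.1 = p.2 z ∧
        ∀ v : Z.erase z, p.2 v = g.2 v
    | Sum.inr v => IsTop c A z p v) ?_ ?_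
  · simpa only [Fintype.card_sum, Fintype.card_prod, Fintype.card_fun, Fintype.card_coe,
      Fintype.card_fin, Finset.card_erase_of_mem hc.mem] using this
  · intro p hp
    rcases noneBelow_or_isTop (z := z) (hs p hp) with h | ⟨v, hv⟩
    · obtain ⟨w, hw, hwz, hws, -⟩ := htw p hp
      exact ⟨Sum.inl (⟨w, hw⟩, fun v => p.2 v), h, hwz, by simpa using hws 0, fun _ => rfl⟩
    · exact ⟨Sum.inr ⟨v, hv.1⟩, hv⟩
  · intro p hp q hq x h1 h2
    have ht : HasTwin c Z z p ↔ HasTwin c Z z q := iff_of_true (htw p hp) (htw q hq)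
    rcases x with g | v
    · obtain ⟨a1, a2, a3, a4⟩ := h1
      obtain ⟨b1, b2, b3, b4⟩ := h2
      have hne : ∀ v ∈ Z, v ≠ z → p.2 v = q.2 v := fun v hv hvz =>
        (a4 ⟨v, Finset.mem_erase.2 ⟨hvz, hv⟩⟩).trans (b4 ⟨v, Finset.mem_erase.2 ⟨hvz, hv⟩⟩).symm
      refine pair_eq_of_noneBelow hc (hs p hp) (hs q hq) (hres p hp q hq) ht
        (fun v hv => ?_) a1 b1
      by_cases hvz : v = z
      · rw [hvz, ← a3, ← b3]; exact hne _ g.1.2 a2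
      · exact hne v hv hvz
    · exact pair_eq_of_isTop hc (hs p hp) (hs q hq) (hres p hp q hq) ht h1 h2

lemma restrictPair_mem (hc : IsExtraCycle c A Z z) {p : (V → V → Prop) × (V → Fin k)}
    (hp : p ∈ compatiblePairs e c k (A ∪ Z)) : restrictPair A p ∈ compatiblePairs e c k A :=
  mem_compatiblePairs.2 ((mem_compatiblePairs.1 hp).restrict Finset.subset_union_left hc.inv)

lemma card_compatiblePairs_union_le_of_fiber (hc : IsExtraCycle c A Z z) (N : ℕ)
    (h : ∀ s ⊆ compatiblePairs e c k (A ∪ Z),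
      (∀ p ∈ s, ∀ q ∈ s, restrictPair A p = restrictPair A q) → s.card ≤ N) :
    (compatiblePairs e c k (A ∪ Z)).card ≤ N * (compatiblePairs e c k A).card := by
  classical
  refine Finset.card_le_mul_card_image_of_maps_to (f := restrictPair A)
    (fun p hp => restrictPair_mem hc hp) N fun b _ => h _ (Finset.filter_subset _ _) ?_
  intro p hp q hq
  rw [(Finset.mem_filter.1 hp).2, (Finset.mem_filter.1 hq).2]

lemma card_compatiblePairs_union_le (hc : IsExtraCycle c A Z z) :
    (compatiblePairs e c k (A ∪ Z)).card ≤
      (k ^ Z.card + A.card + (Z.card * k ^ (Z.card - 1) + A.card)) *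
        (compatiblePairs e c k A).card := by
  classical
  refine card_compatiblePairs_union_le_of_fiber hc _ fun s hs hres => ?_
  rw [← Finset.card_filter_add_card_filter_not (s := s) (fun p => ¬ HasTwin c Z z p)]
  refine Nat.add_le_add ?_ ?_
  · refine card_fiber_no_twin (e := e) hc _ (fun p hp => ?_) (fun p hp q hq => ?_) (fun p hp => ?_)
    · exact mem_compatiblePairs.1 (hs (Finset.mem_filter.1 hp).1)
    · exact hres p (Finset.mem_filter.1 hp).1 q (Finset.mem_filter.1 hq).1
    · exact (Finset.mem_filter.1 hp).2
  · refine card_fiber_twin (e := e) hc _ (fun p hp => ?_) (fun p hp q hq => ?_) (fun p hp => ?_)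
    · exact mem_compatiblePairs.1 (hs (Finset.mem_filter.1 hp).1)
    · exact hres p (Finset.mem_filter.1 hp).1 q (Finset.mem_filter.1 hq).1
    · exact not_not.1 (Finset.mem_filter.1 hp).2

/-- Adding a fixed point multiplies the count by at most `k + |A|` for order-preserving pairs. -/
lemma card_compatiblePairs_insert_le (hc : IsExtraCycle c A {z} z) :
    (compatiblePairs e c k (A ∪ {z})).card ≤ (k + A.card) * (compatiblePairs e c k A).card := by
  refine card_compatiblePairs_union_le_of_fiber hc _ fun s hs hres => ?_
  have := card_fiber_no_twin (e := e) hc s (fun p hp => mem_compatiblePairs.1 (hs hp)) hres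
    (fun p _ ⟨v, hv, hvz, _⟩ => hvz (Finset.mem_singleton.1 hv))
  simpa using this

/-- Order-reversing pairs give distinct colours to distinct fixed points. -/
lemma color_injOn_fixed {p : (V → V → Prop) × (V → Fin k)} (hp : IsCompatible false c A p.1 p.2)
    (hfix : ∀ v ∈ A, c v = v) : Set.InjOn p.2 A := by
  intro u hu v hv huv
  by_contra hne
  have h := hp.step hu hv huv
  rw [hfix u hu, hfix v hv] at h
  simp only [orient, Bool.false_eq_true, if_false] at h
  rcases hp.total hu hv hne with h' | h'
  · exact hp.asymm h' (h.1 h')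
  · exact hp.asymm h' (h.2 h')

/-- Distinct fixed points now carry distinct colours, so the new point avoids |A| colours, and its
colour alone determines its place in the order. -/
lemma card_compatiblePairs_insert_le_sub (hc : IsExtraCycle c A {z} z)
    (hfix : ∀ v ∈ A ∪ {z}, c v = v) :
    (compatiblePairs false c k (A ∪ {z})).card ≤
      (k - A.card) * (compatiblePairs false c k A).card := by
  refine card_compatiblePairs_union_le_of_fiber hc _ fun s hs hres => ?_
  rcases s.eq_empty_or_nonempty with rfl | ⟨p₀, hp₀⟩
  · simp
  have hinj : ∀ {p}, p ∈ s → Set.InjOn p.2 (A ∪ {z} : Finset V) := fun {p} hp =>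
    color_injOn_fixed (mem_compatiblePairs.1 (hs hp)) hfix
  have hzA : z ∉ A := fun h => Finset.disjoint_left.1 hc.disj h hc.mem
  have hcard : ((A.image p₀.2)ᶜ).card = k - A.card := by
    rw [Finset.card_compl, Fintype.card_fin, Finset.card_image_of_injOn]
    exact (hinj hp₀).mono (by simp)
  rw [← hcard]
  refine Finset.card_le_card_of_injOn (fun p => p.2 z) (fun p hp => ?_) (fun p hp q hq h => ?_)
  · simp only [Finset.coe_compl, Set.mem_compl_iff, Finset.mem_coe, Finset.mem_image, not_exists,
      not_and]
    intro v hv heq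
    rw [color_eq_of_restrictPair_eq (hres p₀ hp₀ p hp) hv] at heq
    have : v = z := hinj hp (by simp [hv]) (by simp) heq
    exact hzA (this ▸ hv)
  · have hno : ∀ {p}, p ∈ s → NoneBelow c A z p := fun {p} hp w hw hws => by
      have : w = z := hinj hp (by simp [hw]) (by simp) (by simpa using hws 0)
      exact absurd (this ▸ hw) hzA
    have htw : ∀ p : (V → V → Prop) × (V → Fin k), ¬ HasTwin c {z} z p :=
      fun p ⟨v, hv, hvz, _⟩ => hvz (Finset.mem_singleton.1 hv)
    refine pair_eq_of_noneBelow hc (mem_compatiblePairs.1 (hs hp)) (mem_compatiblePairs.1 (hs hq))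
      (hres p hp q hq) (iff_of_false (htw p) (htw q)) (fun v hv => ?_) (hno hp) (hno hq)
    rw [Finset.mem_singleton.1 hv]; exact h

lemma card_compatiblePairs_empty : (compatiblePairs e c k (∅ : Finset V)).card ≤ 1 := by
  refine Finset.card_le_one.2 fun p hp q hq => ?_
  have hp := mem_compatiblePairs.1 hp
  have hq := mem_compatiblePairs.1 hq
  refine Prod.ext ?_ ?_
  · funext u v
    exact propext ⟨fun h => by simpa using hp.supp h, fun h => by simpa using hq.supp h⟩
  · funext v
    rw [hp.off (by simp), hq.off (by simp)]

/-- The number of pairs `(r, f)` on a set of `m` fixed points. -/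
def fixedCount (e : Bool) (k m : ℕ) : ℕ := if e then k.ascFactorial m else k.descFactorial m

lemma card_compatiblePairs_fixed_le (hfix : ∀ v ∈ A, c v = v) :
    (compatiblePairs e c k A).card ≤ fixedCount e k A.card := by
  induction A using Finset.induction_on with
  | empty => cases e <;> simpa [fixedCount] using card_compatiblePairs_empty
  | insert z A hz ih =>
    have ih := ih fun v hv => hfix v (by simp [hv])
    have hzz : c z = z := hfix z (by simp)
    have hc : IsExtraCycle c A {z} z :=
      { inv := fun v => ⟨fun h => by
            have h2 := hfix (c v) (Finset.mem_insert_of_mem h)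
            rwa [c.injective h2] at h, fun h => by rwa [hfix v (Finset.mem_insert_of_mem h)]⟩
        inv' := fun v => by
          simp only [Finset.mem_singleton]
          exact ⟨fun h => c.injective (h.trans hzz.symm), fun h => by rw [h, hzz]⟩
        disj := by simpa using hz
        mem := by simp
        toBase := fun v hv => ⟨0, by simpa using hv⟩
        fromBase := fun v hv => ⟨0, by simpa [eq_comm] using hv⟩ }
    have hins : insert z A = A ∪ {z} := by ext; simp
    rw [Finset.card_insert_of_notMem hz]
    cases e with
    | true =>
      rw [hins]
      refine (card_compatiblePairs_insert_le hc).trans ?_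
      simp only [fixedCount, if_true, Nat.ascFactorial_succ] at ih ⊢
      exact Nat.mul_le_mul_left _ ih
    | false =>
      rw [hins]
      refine (card_compatiblePairs_insert_le_sub hc (fun v hv => hfix v (hins ▸ hv))).trans ?_
      simp only [fixedCount, Bool.false_eq_true, if_false, Nat.descFactorial_succ] at ih ⊢
      exact Nat.mul_le_mul_left _ ih

end

section

variable {V : Type*} [Fintype V] [DecidableEq V] {k : ℕ} [NeZero k] {e : Bool}
  {c : Equiv.Perm V} {z : V}

lemma isExtraCycle_sameCycle {A : Finset V} (hA : ∀ v, c v ∈ A ↔ v ∈ A) (hz : z ∉ A) :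
    IsExtraCycle c A {v | c.SameCycle z v} z where
  inv := hA
  inv' v := by simp
  disj := by
    rw [Finset.disjoint_left]
    intro v hv hv'
    obtain ⟨j, -, hj⟩ := ((Finset.mem_filter.1 hv').2.symm).exists_pow_eq'
    exact hz (hj ▸ (pow_apply_mem hA j v).2 hv)
  mem := by simp [Equiv.Perm.SameCycle.refl]
  toBase v hv := by
    obtain ⟨j, -, hj⟩ := ((Finset.mem_filter.1 hv).2.symm).exists_pow_eq'
    exact ⟨j, hj⟩
  fromBase v hv := by
    obtain ⟨j, -, hj⟩ := ((Finset.mem_filter.1 hv).2).exists_pow_eq'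
    exact ⟨j, hj⟩

/-- For a cycle of length at least 2 the additive terms cost a relative i/k + 2n/k², which stays
O(n/k + n²/k²) over all cycles. For a fixed point the term a/k would not be negligible; this is why
fixed points are counted separately by `fixedCount`. -/
lemma extension_factor_le {i a n k : ℕ} (hk : 0 < k) (hi : 2 ≤ i) (ha : a ≤ n) :
    ((k ^ i + a + (i * k ^ (i - 1) + a) : ℕ) : ℝ) ≤
      ((k : ℝ) * Real.exp (1 / k + 2 * n / k ^ 2)) ^ i := by
  have hk' : (0 : ℝ) < k := by exact_mod_cast hk
  have hk1 : (1 : ℝ) ≤ k := by exact_mod_cast hk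
  have ha' : (a : ℝ) ≤ n := by exact_mod_cast ha
  have hi' : (2 : ℝ) ≤ i := by exact_mod_cast hi
  obtain ⟨l, rfl⟩ := Nat.exists_eq_add_of_le hi
  rw [mul_pow, ← Real.exp_nat_mul]
  have h1 : ((2 + l : ℕ) : ℝ) * (1 / k + 2 * n / k ^ 2) + 1 ≤
      Real.exp (((2 + l : ℕ) : ℝ) * (1 / k + 2 * n / k ^ 2)) := Real.add_one_le_exp _
  refine le_trans ?_ (mul_le_mul_of_nonneg_left h1 (by positivity))
  have h2 : (1 : ℝ) ≤ (k : ℝ) ^ l := one_le_pow₀ hk1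
  have h3 : (k : ℝ) ^ (2 + l) * (((2 + l : ℕ) : ℝ) * (1 / k + 2 * n / k ^ 2) + 1) =
      k ^ (2 + l) + ((2 + l : ℕ) : ℝ) * k ^ (1 + l) + ((2 + l : ℕ) : ℝ) * (2 * n * k ^ l) := by
    field_simp
    ring
  rw [h3, show 2 + l - 1 = 1 + l by omega]
  have h4 : 2 * (n : ℝ) ≤ 2 * n * k ^ l := by
    have : (0 : ℝ) ≤ n := by positivity
    nlinarith
  have h5 : 2 * (n : ℝ) * k ^ l ≤ ((2 + l : ℕ) : ℝ) * (2 * n * k ^ l) := by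
    have : (0 : ℝ) ≤ 2 * n * k ^ l := by positivity
    nlinarith
  push_cast at h5 ⊢
  linarith

lemma card_compatiblePairs_union_fixed_le (D : Finset V) (hD : ∀ v, c v ∈ D ↔ v ∈ D)
    (hDF : ∀ v ∈ D, c v ≠ v) :
    ((compatiblePairs e c k (({v | c v = v} : Finset V) ∪ D)).card : ℝ) ≤
      (compatiblePairs e c k ({v | c v = v} : Finset V)).card *
        ((k : ℝ) * Real.exp (1 / k + 2 * Fintype.card V / k ^ 2)) ^ D.card := by
  induction D using Finset.strongInduction with
  | H D ih =>
    rcases D.eq_empty_or_nonempty with rfl | ⟨z, hz⟩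
    · simp
    set Z : Finset V := {v | c.SameCycle z v} with hZ
    have hZD : Z ⊆ D := fun v hv => by
      obtain ⟨j, -, hj⟩ := ((Finset.mem_filter.1 hv).2).exists_pow_eq'
      exact hj ▸ (pow_apply_mem hD j z).2 hz
    have hzZ : z ∈ Z := by simp [hZ, Equiv.Perm.SameCycle.refl]
    have hinvZ : ∀ v, c v ∈ Z ↔ v ∈ Z := fun v => by simp [hZ]
    have hD' : ∀ v, c v ∈ D \ Z ↔ v ∈ D \ Z := fun v => by
      simp only [Finset.mem_sdiff, hD, hinvZ]
    have ih' := ih (D \ Z) (Finset.ssubset_iff_of_subset Finset.sdiff_subset |>.2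
      ⟨z, hz, by simp [hzZ]⟩) hD' (fun v hv => hDF v (Finset.mem_sdiff.1 hv).1)
    set A : Finset V := ({v | c v = v} : Finset V) ∪ D \ Z with hAdef
    have hA : ∀ v, c v ∈ A ↔ v ∈ A := fun v => by
      simp only [hAdef, Finset.mem_union, hD', Finset.mem_filter, Finset.mem_univ, true_and,
        c.injective.eq_iff]
    have hzA : z ∉ A := by simp [hAdef, hzZ, hDF z hz]
    have hc := isExtraCycle_sameCycle (c := c) hA hzA
    have hcard : 2 ≤ Z.card := by
      refine Finset.one_lt_card.2 ⟨z, hzZ, c z, (hinvZ z).2 hzZ, (hDF z hz).symm⟩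
    have hun : ({v | c v = v} : Finset V) ∪ D = A ∪ Z := by
      rw [hAdef, Finset.union_assoc, Finset.sdiff_union_of_subset hZD]
    have hDc : D.card = (D \ Z).card + Z.card := (Finset.card_sdiff_add_card_eq_card hZD).symm
    have hk : 0 < k := Nat.pos_of_ne_zero (NeZero.ne k)
    have h1 := (Nat.cast_le (α := ℝ)).2 (card_compatiblePairs_union_le (e := e) (k := k) hc)
    rw [Nat.cast_mul] at h1
    rw [hun, hDc, pow_add, ← mul_assoc]
    refine h1.trans ?_
    rw [mul_comm]
    refine mul_le_mul ih' ?_ (by positivity) (by positivity)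
    exact extension_factor_le hk hcard (Finset.card_le_univ A)

/-- The number of fixed points. -/
def fixedNumber (c : Equiv.Perm V) : ℕ := ({v | c v = v} : Finset V).card

theorem card_compatiblePairs_le :
    ((compatiblePairs e c k univ).card : ℝ) ≤
      fixedCount e k (fixedNumber c) *
        ((k : ℝ) * Real.exp (1 / k + 2 * Fintype.card V / k ^ 2)) ^
          (Fintype.card V - fixedNumber c) := by
  have h := card_compatiblePairs_union_fixed_le (e := e) (k := k) (c := c)
    ({v | c v = v} : Finset V)ᶜ (by simp) (by simp)
  rw [Finset.union_compl, Finset.card_compl] at h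
  refine h.trans (mul_le_mul_of_nonneg_right ?_ (by positivity))
  exact_mod_cast card_compatiblePairs_fixed_le (by simp)

end

/-! ### Sorting: compatible pairs as words with prescribed strict steps. -/

open Classical in
lemma card_strictMono_fin (n m : ℕ) :
    ({w : Fin n → Fin m | StrictMono w} : Finset _).card = m.choose n := by
  have : m.choose n = (powersetCard n (univ : Finset (Fin m))).card := by simp
  rw [this]
  refine Finset.card_bij (fun w _ => univ.image w) ?_ ?_ ?_
  · intro w hw
    have hw := (Finset.mem_filter.1 hw).2
    simp [Finset.mem_powersetCard, Finset.card_image_of_injective _ hw.injective]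
  · intro w hw w' hw' h
    have hw := (Finset.mem_filter.1 hw).2
    have hw' := (Finset.mem_filter.1 hw').2
    refine (hw.range_inj hw').1 ?_
    simpa using congrArg (fun s : Finset (Fin m) => (s : Set (Fin m))) h
  · intro s hs
    have hs := (Finset.mem_powersetCard.1 hs).2
    exact ⟨s.orderEmbOfFin hs, by simp [OrderEmbedding.strictMono], by simp⟩

/-- Weakly increasing words that increase strictly at the steps in `P`. -/
def IsWordStrictAt {n k : ℕ} (P : Fin n → Prop) (w : Fin (n + 1) → Fin k) : Prop :=
  ∀ i : Fin n, w i.castSucc ≤ w i.succ ∧ (P i → w i.castSucc < w i.succ)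

open Classical in
/-- The number of steps before `i` that are not in `P`. -/
noncomputable def weakBefore {n : ℕ} (P : Fin n → Prop) (i : Fin (n + 1)) : ℕ :=
  ({j : Fin n | j.castSucc < i ∧ ¬ P j} : Finset _).card

open Classical in
lemma weakBefore_succ {n : ℕ} (P : Fin n → Prop) (i : Fin n) :
    weakBefore P i.succ = weakBefore P i.castSucc + if P i then 0 else 1 := by
  unfold weakBefore
  by_cases hP : P i
  · simp only [hP, if_true, add_zero]
    congr 1
    ext j
    simp only [mem_filter, mem_univ, true_and, Fin.castSucc_lt_succ_iff, Fin.castSucc_lt_castSucc_iff]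
    constructor
    · rintro ⟨h1, h2⟩
      exact ⟨lt_of_le_of_ne h1 (fun h => h2 (h ▸ hP)), h2⟩
    · exact fun ⟨h1, h2⟩ => ⟨h1.le, h2⟩
  · simp only [hP, if_false]
    rw [← Finset.card_insert_of_notMem (a := i) (by simp)]
    congr 1
    ext j
    simp only [mem_filter, mem_univ, true_and, Fin.castSucc_lt_succ_iff,
      Fin.castSucc_lt_castSucc_iff, mem_insert]
    constructor
    · rintro ⟨h1, h2⟩
      exact h1.eq_or_lt.imp id (fun h => ⟨h, h2⟩)
    · rintro (rfl | ⟨h1, h2⟩)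
      · exact ⟨le_rfl, hP⟩
      · exact ⟨h1.le, h2⟩

open Classical in
lemma weakBefore_last {n : ℕ} (P : Fin n → Prop) :
    weakBefore P (Fin.last n) = ({j : Fin n | ¬ P j} : Finset _).card := by
  simp [weakBefore, Fin.castSucc_lt_last]

lemma weakBefore_zero {n : ℕ} (P : Fin n → Prop) : weakBefore P 0 = 0 := by
  simp [weakBefore]

lemma weakBefore_mono {n : ℕ} (P : Fin n → Prop) : Monotone (weakBefore P) := by
  classical
  rw [Fin.monotone_iff_le_succ]
  intro i
  rw [weakBefore_succ]; omega

open Classical in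
/-- The number of weakly increasing words of length `n + 1` over `k` letters with prescribed
strict steps. -/
lemma card_words_strictAt {n : ℕ} (k : ℕ) (P : Fin n → Prop) :
    ({w : Fin (n + 1) → Fin k | IsWordStrictAt P w} : Finset _).card =
      (k + ({j : Fin n | ¬ P j} : Finset _).card).choose (n + 1) := by
  rw [← card_strictMono_fin]
  set q := ({j : Fin n | ¬ P j} : Finset _).card with hq
  have hle : ∀ i, weakBefore P i ≤ q := fun i => by
    rw [hq, ← weakBefore_last]; exact weakBefore_mono P (Fin.le_last i)
  -- Adding to each letter the number of earlier weak steps makes every step strict and enlarges the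
  -- alphabet by the total number of weak steps.
  refine Finset.card_bij (fun w _ i => (⟨w i + weakBefore P i,
    by have := hle i; have := (w i).2; omega⟩ : Fin (k + q))) ?_ ?_ ?_
  · intro w hw
    have hw : IsWordStrictAt P w := (Finset.mem_filter.1 hw).2
    simp only [mem_filter, mem_univ, true_and, Fin.strictMono_iff_lt_succ]
    intro i
    rw [Fin.mk_lt_mk, weakBefore_succ]
    by_cases hP : P i
    · have := (hw i).2 hP
      rw [Fin.lt_def] at this
      simp only [hP, if_true]; omega
    · have := (hw i).1
      rw [Fin.le_def] at this
      simp only [hP, if_false]; omega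
  · intro w _ w' _ h
    funext i
    have := congrFun h i
    simp only [Fin.mk.injEq] at this
    ext; omega
  · intro w' hw'
    have hw' : StrictMono w' := (Finset.mem_filter.1 hw').2
    have hstep : ∀ i : Fin n, (w' i.castSucc : ℕ) < w' i.succ := fun i =>
      hw' (Fin.castSucc_lt_succ)
    have hlow : ∀ i, weakBefore P i ≤ w' i := fun i => by
      induction i using Fin.induction with
      | zero => rw [weakBefore_zero]; omega
      | succ i ih =>
        rw [weakBefore_succ]
        have := hstep i
        split_ifs <;> omega
    have hmono : Monotone fun i => (w' i : ℕ) - weakBefore P i := by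
      rw [Fin.monotone_iff_le_succ]
      intro i
      have := hstep i
      simp only [weakBefore_succ]
      split_ifs <;> omega
    have hup : ∀ i, (w' i : ℕ) - weakBefore P i < k := fun i => by
      have h1 := hmono (Fin.le_last i)
      have h2 := (w' (Fin.last n)).2
      have h3 := hlow (Fin.last n)
      simp only [weakBefore_last] at h1 h3
      omega
    refine ⟨fun i => ⟨(w' i : ℕ) - weakBefore P i, hup i⟩, ?_, ?_⟩
    · simp only [mem_filter, mem_univ, true_and]
      intro i
      have h1 := hstep i
      have h2 := hlow i.castSucc
      have h3 := hlow i.succ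
      rw [Fin.mk_le_mk, Fin.mk_lt_mk]
      simp only [weakBefore_succ] at h3 ⊢
      constructor
      · split_ifs at h3 ⊢ <;> omega
      · intro hP
        simp only [hP, if_true] at h3 ⊢
        omega
    · funext i
      have := hlow i
      ext
      simp only
      omega

/-- The steps of `π` at which a compatible word has to increase. -/
def strictStep {n : ℕ} (e : Bool) (π : Equiv.Perm (Fin (n + 1))) (i : Fin n) : Prop :=
  ¬ orient e (· < ·) (π i.castSucc) (π i.succ)

section

variable {n k : ℕ} [NeZero k] {e : Bool}

lemma orient_trans {e : Bool} {α : Type*} [Preorder α] {a b c : α} (h : orient e (· < ·) a b)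
    (h' : orient e (· < ·) b c) : orient e (· < ·) a c := by
  cases e with
  | true => simp only [orient, if_true] at *; exact h.trans h'
  | false => simp only [orient, Bool.false_eq_true, if_false] at *; exact h'.trans h

lemma orient_asymm {e : Bool} {α : Type*} [Preorder α] {a b : α} (h : orient e (· < ·) a b) :
    ¬ orient e (· < ·) b a := by
  cases e with
  | true => simp only [orient, if_true] at *; exact h.asymm
  | false => simp only [orient, Bool.false_eq_true, if_false] at *; exact h.asymm

lemma orient_of_color_eq {π : Equiv.Perm (Fin (n + 1))} {w : Fin (n + 1) → Fin k}
    (hw : IsWordStrictAt (strictStep e π) w) {i j : Fin (n + 1)} (hij : i < j) (h : w i = w j) :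
    orient e (· < ·) (π i) (π j) := by
  have hmono : Monotone w := Fin.monotone_iff_le_succ.2 fun i => (hw i).1
  induction j using Fin.induction with
  | zero => simp at hij
  | succ j ih =>
    have hij' : i ≤ j.castSucc := Fin.le_castSucc_iff.2 hij
    have h1 : w i ≤ w j.castSucc := hmono hij'
    have h2 : w j.castSucc ≤ w j.succ := (hw j).1
    have h3 : w j.castSucc = w j.succ := le_antisymm h2 (h ▸ h1)
    have h4 : orient e (· < ·) (π j.castSucc) (π j.succ) := by
      by_contra h5
      exact ((hw j).2 h5).ne h3
    rcases hij'.eq_or_lt with rfl | hlt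
    · exact h4
    · exact orient_trans (ih hlt (h.trans h3.symm)) h4

/-- Since w is weakly increasing, each colour class is an interval of positions. Compatibility
inside it therefore reduces to consecutive positions of the conjugate of c by σ. -/
lemma isCompatible_of_word {c σ : Equiv.Perm (Fin (n + 1))} {w : Fin (n + 1) → Fin k} :
    IsCompatible e c univ (fun u v => σ u < σ v) (fun v => w (σ v)) ↔
      IsWordStrictAt (strictStep e (σ * c * σ⁻¹)) w := by
  constructor
  · intro h i
    have hle : w i.castSucc ≤ w i.succ := by
      by_contra hlt
      have := h.mono (u := σ⁻¹ i.succ) (v := σ⁻¹ i.castSucc) (by simp) (by simp)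
        (by simpa using hlt)
      replace this : i.succ < i.castSucc := by simpa using this
      exact absurd this (Fin.castSucc_lt_succ).asymm
    refine ⟨hle, fun hP => lt_of_le_of_ne hle fun heq => hP ?_⟩
    have := (h.step (u := σ⁻¹ i.castSucc) (v := σ⁻¹ i.succ) (by simp) (by simp)
        (by simpa using heq)).1 (by simp)
    simpa [orient, Equiv.Perm.mul_apply] using this
  · intro hw
    have hmono : Monotone w := Fin.monotone_iff_le_succ.2 fun i => (hw i).1
    have key : ∀ {u v}, σ u < σ v → w (σ u) = w (σ v) →
        orient e (· < ·) (σ (c u)) (σ (c v)) := fun {u v} hlt heq => by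
      simpa [Equiv.Perm.mul_apply] using orient_of_color_eq hw hlt heq
    refine ⟨by simp, by simp, by simp, fun h1 h2 => h1.trans h2, ?_, ?_, ?_⟩
    · intro u v _ _ huv
      exact lt_or_gt_of_ne (fun h => huv (σ.injective h))
    · intro u v _ _ hlt
      exact hmono.reflect_lt hlt
    · intro u v _ _ heq
      have hconv : orient e (fun u v => σ u < σ v) (c u) (c v) ↔
          orient e (· < ·) (σ (c u)) (σ (c v)) := by simp [orient]
      rw [hconv]
      refine ⟨fun h => key h heq, fun h => ?_⟩
      by_contra hn
      rcases (not_lt.1 hn).eq_or_lt with h1 | h1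
      · rw [σ.injective h1] at h
        exact orient_asymm h h
      · exact orient_asymm h (key h1 heq.symm)

/-- The permutation sends each point to its rank, the number of points below it. -/
lemma exists_perm_of_isCompatible {c : Equiv.Perm (Fin (n + 1))}
    {r : Fin (n + 1) → Fin (n + 1) → Prop} {f : Fin (n + 1) → Fin k}
    (h : IsCompatible e c univ r f) :
    ∃ σ : Equiv.Perm (Fin (n + 1)), r = fun u v => σ u < σ v := by
  classical
  let g : Fin (n + 1) → Fin (n + 1) := fun u => ⟨({v | r v u} : Finset _).card, by
    calc ({v | r v u} : Finset _).card < (univ : Finset (Fin (n + 1))).card :=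
          Finset.card_lt_card ((Finset.ssubset_univ_iff).2 fun hu => by
            have : u ∈ ({v | r v u} : Finset _) := by rw [hu]; exact mem_univ u
            exact h.irrefl u (Finset.mem_filter.1 this).2)
      _ = n + 1 := by simp⟩
  have hg : ∀ {u v}, r u v → g u < g v := fun {u v} huv => by
    rw [Fin.mk_lt_mk]
    refine Finset.card_lt_card (Finset.ssubset_iff_of_subset ?_ |>.2 ⟨u, ?_, ?_⟩)
    · intro x hx
      simp only [mem_filter, mem_univ, true_and] at hx ⊢
      exact h.trans hx huv
    · simpa using huv
    · simpa using h.irrefl u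
  have hinj : Function.Injective g := fun u v huv => by
    by_contra hne
    rcases h.total (mem_univ u) (mem_univ v) hne with h' | h'
    · exact (hg h').ne huv
    · exact (hg h').ne huv.symm
  refine ⟨Equiv.ofBijective g (Finite.injective_iff_bijective.1 hinj), ?_⟩
  funext u v
  refine propext ⟨fun huv => hg huv, fun huv => ?_⟩
  by_contra hn
  by_cases hne : u = v
  · subst hne; exact lt_irrefl _ huv
  · exact lt_asymm huv (hg ((h.total (mem_univ u) (mem_univ v) hne).resolve_left hn))

lemma equiv_eq_of_lt_iff {α : Type*} {m : ℕ} {σ τ : α ≃ Fin m}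
    (h : ∀ u v, σ u < σ v ↔ τ u < τ v) : σ = τ := by
  have hm : StrictMono (τ ∘ σ.symm) := fun a b hab => by
    have := h (σ.symm a) (σ.symm b)
    simp only [Equiv.apply_symm_apply] at this
    exact this.1 hab
  have hid : τ ∘ σ.symm = id := by
    refine (hm.range_inj strictMono_id).1 ?_
    rw [Set.range_id, (τ.surjective.comp σ.symm.surjective).range_eq]
  ext v
  have := congrFun hid (σ v)
  simp at this
  rw [this]

open Classical in
/-- Compatible pairs, counted by the permutation that sorts the order. -/
theorem card_compatiblePairs_univ (c : Equiv.Perm (Fin (n + 1))) :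
    (compatiblePairs e c k univ).card = ∑ σ : Equiv.Perm (Fin (n + 1)),
      (k + ({i : Fin n | ¬ strictStep e (σ * c * σ⁻¹) i} : Finset _).card).choose (n + 1) := by
  simp_rw [← card_words_strictAt]
  rw [← Finset.card_sigma]
  symm
  refine Finset.card_bij (fun x _ => (fun u v => x.1 u < x.1 v, fun v => x.2 (x.1 v))) ?_ ?_ ?_
  · rintro ⟨σ, w⟩ hx
    simp only [mem_sigma, mem_univ, true_and, mem_filter] at hx
    exact mem_compatiblePairs.2 (isCompatible_of_word.2 hx)
  · rintro ⟨σ, w⟩ _ ⟨τ, w'⟩ _ h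
    obtain ⟨h1, h2⟩ := Prod.ext_iff.1 h
    have : σ = τ := equiv_eq_of_lt_iff fun u v => iff_of_eq (congrFun (congrFun h1 u) v)
    subst this
    congr 1
    funext i
    simpa using congrFun h2 (σ⁻¹ i)
  · rintro ⟨r, f⟩ hp
    have hp := mem_compatiblePairs.1 hp
    obtain ⟨σ, hσ⟩ := exists_perm_of_isCompatible hp
    have hf : f = fun v => (f ∘ σ.symm) (σ v) := by funext v; simp
    refine ⟨⟨σ, f ∘ σ.symm⟩, ?_, Prod.ext hσ.symm hf.symm⟩
    simp only [mem_sigma, mem_univ, true_and, mem_filter]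
    refine isCompatible_of_word.1 ?_
    rw [← hf, ← hσ]
    exact hp

lemma descentNumber_eq (π : Equiv.Perm (Fin (n + 1))) :
    descentNumber π = ({i : Fin n | π i.succ < π i.castSucc} : Finset _).card := by
  unfold descentNumber descentSet
  rw [← Finset.card_map (s := ({i : Fin n | π i.succ < π i.castSucc} : Finset (Fin n)))
    (Fin.castSuccEmb)]
  refine congrArg Finset.card ?_
  ext i
  simp only [mem_filter, mem_univ, true_and, mem_map, Fin.coe_castSuccEmb]
  constructor
  · rintro ⟨h, hlt⟩
    exact ⟨⟨i, by omega⟩, hlt, rfl⟩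
  · rintro ⟨j, hj, rfl⟩
    exact ⟨by simp, hj⟩

lemma descentNumber_le (π : Equiv.Perm (Fin (n + 1))) : descentNumber π ≤ n := by
  rw [descentNumber_eq]
  exact (Finset.card_le_univ _).trans_eq (Fintype.card_fin n)

/-- The number of steps where a compatible word may stay constant. -/
def weakSteps {n : ℕ} (e : Bool) (π : Equiv.Perm (Fin (n + 1))) : ℕ :=
  if e then n - descentNumber π else descentNumber π

open Classical in
lemma card_not_strictStep (π : Equiv.Perm (Fin (n + 1))) :
    ({i : Fin n | ¬ strictStep e π i} : Finset _).card = weakSteps e π := by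
  cases e with
  | true =>
    simp only [strictStep, orient, if_true, not_not, weakSteps, descentNumber_eq]
    have h := Finset.card_filter_add_card_filter_not (s := (univ : Finset (Fin n)))
      (fun i => π i.succ < π i.castSucc)
    have h2 : ({i : Fin n | ¬ π i.succ < π i.castSucc} : Finset (Fin n)) =
        ({i : Fin n | π i.castSucc < π i.succ} : Finset (Fin n)) := by
      ext i
      simp only [mem_filter, mem_univ, true_and, not_lt]
      exact ⟨fun h => lt_of_le_of_ne h fun h' =>
        (Fin.castSucc_lt_succ (i := i)).ne (π.injective h'), fun h => h.le⟩
    rw [h2] at h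
    simp only [card_univ, Fintype.card_fin] at h
    omega
  | false =>
    simp [strictStep, orient, weakSteps, descentNumber_eq]

theorem card_compatiblePairs_eq_sum_choose (c : Equiv.Perm (Fin (n + 1))) :
    (compatiblePairs e c k univ).card = ∑ σ : Equiv.Perm (Fin (n + 1)),
      (k + weakSteps e (σ * c * σ⁻¹)).choose (n + 1) := by
  classical
  rw [card_compatiblePairs_univ]
  exact Finset.sum_congr rfl fun σ _ => by rw [← card_not_strictStep]

end

/-! ### Lower bound: most colourings separate the moved points. -/

section generic

variable {X : Type*} [Fintype X] [DecidableEq X] {k : ℕ}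

lemma card_functions_eq_at {a b : X} (hab : a ≠ b) :
    ({g : X → Fin k | g a = g b} : Finset _).card * k ≤ k ^ Fintype.card X := by
  have hpos : 0 < Fintype.card X := Fintype.card_pos_iff.2 ⟨a⟩
  have h : ({g : X → Fin k | g a = g b} : Finset _).card ≤
      Fintype.card ({y : X // y ≠ a} → Fin k) := by
    refine card_le_card_of_code _ (fun g x => ∀ y : {y : X // y ≠ a}, g y = x y) ?_ ?_
    · exact fun g _ => ⟨fun y => g y, fun _ => rfl⟩
    · intro g hg g' hg' x h1 h2
      have hne : ∀ y, y ≠ a → g y = g' y := fun y hy => (h1 ⟨y, hy⟩).trans (h2 ⟨y, hy⟩).symm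
      funext y
      by_cases hy : y = a
      · rw [hy, (Finset.mem_filter.1 hg).2, (Finset.mem_filter.1 hg').2, hne b hab.symm]
      · exact hne y hy
  have hcard : Fintype.card {y : X // y ≠ a} = Fintype.card X - 1 := by
    simp [Fintype.card_subtype_compl]
  rw [Fintype.card_fun, Fintype.card_fin, hcard] at h
  calc _ ≤ k ^ (Fintype.card X - 1) * k := Nat.mul_le_mul_right _ h
    _ = _ := by rw [← pow_succ, Nat.sub_add_cancel hpos]

lemma card_functions_eq_at_two {a a' b b' : X} (haa : a ≠ a') (hab : b ≠ a) (hab' : b ≠ a')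
    (hba : b' ≠ a) (hba' : b' ≠ a') :
    ({g : X → Fin k | g a = g b ∧ g a' = g b'} : Finset _).card * k ^ 2 ≤ k ^ Fintype.card X := by
  have h : ({g : X → Fin k | g a = g b ∧ g a' = g b'} : Finset _).card ≤
      Fintype.card ({y : X // y ∉ ({a, a'} : Finset X)} → Fin k) := by
    refine card_le_card_of_code _
      (fun g x => ∀ y : {y : X // y ∉ ({a, a'} : Finset X)}, g y = x y) ?_ ?_
    · exact fun g _ => ⟨fun y => g y, fun _ => rfl⟩
    · intro g hg g' hg' x h1 h2
      have hne : ∀ y, y ≠ a → y ≠ a' → g y = g' y := fun y hy hy' =>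
        (h1 ⟨y, by simp [hy, hy']⟩).trans (h2 ⟨y, by simp [hy, hy']⟩).symm
      obtain ⟨p1, p2⟩ := (Finset.mem_filter.1 hg).2
      obtain ⟨q1, q2⟩ := (Finset.mem_filter.1 hg').2
      funext y
      by_cases hy : y = a
      · rw [hy, p1, q1, hne b hab hab']
      by_cases hy' : y = a'
      · rw [hy', p2, q2, hne b' hba hba']
      · exact hne y hy hy'
  have hcard : Fintype.card {y : X // y ∉ ({a, a'} : Finset X)} = Fintype.card X - 2 := by
    rw [Fintype.card_subtype_compl, Fintype.card_coe, Finset.card_pair haa]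
  have htwo : 2 ≤ Fintype.card X := by
    rw [← Finset.card_pair haa]; exact Finset.card_le_univ _
  rw [Fintype.card_fun, Fintype.card_fin, hcard] at h
  calc _ ≤ k ^ (Fintype.card X - 2) * k ^ 2 := Nat.mul_le_mul_right _ h
    _ = _ := by rw [← pow_add, Nat.sub_add_cancel htwo]

/-- Colourings that distinguish any two points within two steps of `c`. -/
def IsSeparating (c : Equiv.Perm X) (g : X → Fin k) : Prop :=
  ∀ u v, u ≠ v → g u = g v → g (c u) ≠ g (c v)

open Classical in
lemma card_separating (hk : 0 < k) (c : Equiv.Perm X) (hc : ∀ v, c v ≠ v) :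
    (k : ℝ) ^ Fintype.card X * (1 - Fintype.card X / k - (Fintype.card X : ℝ) ^ 2 / k ^ 2) ≤
      (({g : X → Fin k | IsSeparating c g} : Finset _).card : ℝ) := by
  have hk' : (0 : ℝ) < k := by exact_mod_cast hk
  set x := Fintype.card X
  -- The two coincidences of a failing pair cost a factor k² only when they constrain two different
  -- points independently. If one point is the image of the other, a single coincidence is used
  -- instead; there are only |X| such events, each costing a factor k.
  let T : X × X → Finset (X → Fin k) := fun a =>
    if a.1 ≠ a.2 ∧ a.2 ≠ c a.1 ∧ a.1 ≠ c a.2 then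
      ({g : X → Fin k | g a.1 = g a.2 ∧ g (c a.1) = g (c a.2)} : Finset (X → Fin k)) else ∅
  have hbad : ({g : X → Fin k | ¬ IsSeparating c g} : Finset _) ⊆
      (univ.biUnion fun u => ({g : X → Fin k | g u = g (c u)} : Finset _)) ∪ univ.biUnion T := by
    intro g hg
    have hg : ¬ IsSeparating c g := (Finset.mem_filter.1 hg).2
    simp only [IsSeparating, not_forall, not_not] at hg
    obtain ⟨u, v, huv, h1, h2⟩ := hg
    rw [Finset.mem_union, Finset.mem_biUnion, Finset.mem_biUnion]
    by_cases hv : v = c u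
    · exact Or.inl ⟨u, mem_univ _, by simpa [hv] using h1⟩
    by_cases hu : u = c v
    · exact Or.inl ⟨v, mem_univ _, by simpa [hu] using h1.symm⟩
    · exact Or.inr ⟨(u, v), mem_univ _, by simp [T, huv, hv, hu, h1, h2]⟩
  have hT : ∀ a, ((T a).card : ℝ) ≤ (k : ℝ) ^ x / k ^ 2 := fun a => by
    by_cases ha : a.1 ≠ a.2 ∧ a.2 ≠ c a.1 ∧ a.1 ≠ c a.2
    · rw [le_div_iff₀ (by positivity)]
      have := card_functions_eq_at_two (k := k) (a := a.1) (a' := c a.1) (b := a.2) (b' := c a.2)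
        (hc _).symm ha.1.symm ha.2.1 ha.2.2.symm (fun h => ha.1 (c.injective h).symm)
      simp only [T, if_pos ha]
      exact_mod_cast this
    · simp only [T, if_neg ha]; simp; positivity
  have hU : ∀ u, ((({g : X → Fin k | g u = g (c u)} : Finset _).card : ℝ)) ≤ (k : ℝ) ^ x / k :=
    fun u => by
      rw [le_div_iff₀ (by positivity)]
      exact_mod_cast card_functions_eq_at (k := k) (hc u).symm
  have hbadcard : ((({g : X → Fin k | ¬ IsSeparating c g} : Finset _).card : ℝ)) ≤
      x * ((k : ℝ) ^ x / k) + x ^ 2 * ((k : ℝ) ^ x / k ^ 2) := by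
    calc ((({g : X → Fin k | ¬ IsSeparating c g} : Finset _).card : ℝ))
        ≤ ((∑ u, ({g : X → Fin k | g u = g (c u)} : Finset _).card + ∑ a, (T a).card : ℕ) : ℝ) := by
          exact_mod_cast (Finset.card_le_card hbad).trans ((Finset.card_union_le _ _).trans
            (Nat.add_le_add Finset.card_biUnion_le Finset.card_biUnion_le))
      _ = ∑ u, (({g : X → Fin k | g u = g (c u)} : Finset _).card : ℝ) +
            ∑ a, ((T a).card : ℝ) := by push_cast; rfl
      _ ≤ ∑ _u : X, (k : ℝ) ^ x / k + ∑ _a : X × X, (k : ℝ) ^ x / k ^ 2 :=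
          add_le_add (Finset.sum_le_sum fun u _ => hU u) (Finset.sum_le_sum fun a _ => hT a)
      _ = _ := by simp [x, sq]
  have htot := Finset.card_filter_add_card_filter_not (s := (univ : Finset (X → Fin k)))
    (fun g => IsSeparating c g)
  have htot' : ((({g : X → Fin k | IsSeparating c g} : Finset _).card : ℝ)) +
      ((({g : X → Fin k | ¬ IsSeparating c g} : Finset _).card : ℝ)) = (k : ℝ) ^ x := by
    rw [← Nat.cast_add, htot]; simp [x]
  have : (k : ℝ) ^ x * (1 - x / k - (x : ℝ) ^ 2 / k ^ 2) =
      (k : ℝ) ^ x - (x * ((k : ℝ) ^ x / k) + x ^ 2 * ((k : ℝ) ^ x / k ^ 2)) := by ring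
  rw [this]
  linarith

end generic

/-- Words allowed on the fixed points: weakly (`e = true`) or strictly increasing. -/
def IsFixedWord {m k : ℕ} (e : Bool) (w : Fin m → Fin k) : Prop :=
  Monotone w ∧ (e = false → StrictMono w)

-- The factor m! counts the orders in which the fixed points can be listed. The product equals
-- `fixedCount`, so upper and lower bounds agree exactly on the fixed points.
open Classical in
lemma card_fixedWord (e : Bool) (m k : ℕ) :
    m.factorial * ({w : Fin m → Fin k | IsFixedWord e w} : Finset _).card = fixedCount e k m := by
  cases m with
  | zero =>
    have : ({w : Fin 0 → Fin k | IsFixedWord e w} : Finset _) = univ := by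
      ext w
      simp only [mem_filter, mem_univ, true_and, iff_true]
      exact ⟨fun a => a.elim0, fun _ a => a.elim0⟩
    rw [this]
    cases e <;> simp [fixedCount]
  | succ n =>
    have : ({w : Fin (n + 1) → Fin k | IsFixedWord e w} : Finset (Fin (n + 1) → Fin k)) =
        ({w : Fin (n + 1) → Fin k | IsWordStrictAt (fun _ => e = false) w} :
          Finset (Fin (n + 1) → Fin k)) := by
      refine Finset.filter_congr fun w _ => ?_
      rw [IsFixedWord, Fin.monotone_iff_le_succ, Fin.strictMono_iff_lt_succ]
      exact ⟨fun h i => ⟨h.1 i, fun he => h.2 he i⟩, fun h => ⟨fun i => (h i).1,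
        fun he i => (h i).2 he⟩⟩
    rw [this, card_words_strictAt]
    cases e with
    | true =>
      simp only [fixedCount, if_true, Nat.ascFactorial_eq_factorial_mul_choose']
      simp [← add_assoc]
    | false =>
      rw [fixedCount, if_neg (by simp), Nat.descFactorial_eq_factorial_mul_choose]
      simp

/-! ### Lower bound: the signed lexicographic order of a separating colouring. -/

section

variable {V : Type*} [Fintype V] [DecidableEq V] {k : ℕ} {e : Bool} {c : Equiv.Perm V}

/-- The colour sequence along the orbit of `v`, with alternating signs when `e = false`, as an
element of the lexicographically ordered space of sequences. -/
def signedWord (e : Bool) (c : Equiv.Perm V) (f : V → Fin k) (v : V) : Lex (ℕ → ℤ) :=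
  toLex fun j => (if e then 1 else -1) ^ j * ((f ((c ^ j) v) : ℕ) : ℤ)

lemma signedWord_lt_iff {f : V → Fin k} {u v : V} :
    signedWord e c f u < signedWord e c f v ↔
      ∃ j, (∀ i < j, f ((c ^ i) u) = f ((c ^ i) v)) ∧
        orient (e || decide (Even j)) (· < ·) (f ((c ^ j) u)) (f ((c ^ j) v)) := by
  have hsign : ∀ j : ℕ, ((if e then 1 else -1 : ℤ)) ^ j =
      if (e || decide (Even j)) = true then 1 else -1 := fun j => by
    cases e
    · rcases Nat.even_or_odd j with h | h
      · simp [h]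
      · simp [h, Nat.not_even_iff_odd.2 h]
    · simp
  change (∃ j, (∀ i < j, (if e then 1 else -1 : ℤ) ^ i * ((f ((c ^ i) u) : ℕ) : ℤ) =
      (if e then 1 else -1) ^ i * ((f ((c ^ i) v) : ℕ) : ℤ)) ∧
    (if e then 1 else -1 : ℤ) ^ j * ((f ((c ^ j) u) : ℕ) : ℤ) <
      (if e then 1 else -1) ^ j * ((f ((c ^ j) v) : ℕ) : ℤ)) ↔ _
  refine exists_congr fun j => and_congr (forall₂_congr fun i _ => ?_) ?_
  · rw [mul_right_inj' (by rw [hsign]; split_ifs <;> simp)]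
    rw [Int.natCast_inj, Fin.val_inj]
  · rw [hsign]
    by_cases h : (e || decide (Even j)) = true
    · simp [orient, h]
    · simp [orient, h]

lemma signedWord_inj {f : V → Fin k} {u v : V} (h : signedWord e c f u = signedWord e c f v) :
    SameWord c f u v := fun j => by
  have := congrFun (congrArg ofLex h) j
  simp only [signedWord, ofLex_toLex] at this
  rw [mul_right_inj' (by cases e <;> simp)] at this
  exact Fin.val_injective (by exact_mod_cast this)

lemma signedWord_lt_of_lt {f : V → Fin k} {u v : V} (h : f u < f v) :
    signedWord e c f u < signedWord e c f v :=
  signedWord_lt_iff.2 ⟨0, by simp, by simpa [orient] using h⟩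

/-- Removing a common first letter keeps the lexicographic comparison. In the reversing case it also
flips the sign of every remaining letter, and hence the comparison. -/
lemma signedWord_shift {f : V → Fin k} {u v : V} (h : f u = f v)
    (hlt : signedWord e c f u < signedWord e c f v) :
    orient e (· < ·) (signedWord e c f (c u)) (signedWord e c f (c v)) := by
  obtain ⟨j, hj, hlt⟩ := signedWord_lt_iff.1 hlt
  cases j with
  | zero => simp [orient, h] at hlt
  | succ j =>
    have hj' : ∀ i < j, f ((c ^ i) (c u)) = f ((c ^ i) (c v)) := fun i hi => by
      have := hj (i + 1) (by omega)
      rwa [pow_succ, Equiv.Perm.mul_apply, Equiv.Perm.mul_apply] at this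
    rw [pow_succ, Equiv.Perm.mul_apply, Equiv.Perm.mul_apply] at hlt
    cases e with
    | true =>
      simp only [orient, if_true]
      exact signedWord_lt_iff.2 ⟨j, hj', by simpa [orient] using hlt⟩
    | false =>
      simp only [orient, Bool.false_eq_true, if_false]
      refine signedWord_lt_iff.2 ⟨j, fun i hi => (hj' i hi).symm, ?_⟩
      rcases Nat.even_or_odd j with hev | hod
      · simpa [orient, Nat.even_add_one, hev] using hlt
      · simpa [orient, Nat.even_add_one, Nat.not_even_iff_odd.2 hod] using hlt

/-- The order by words, with ties broken by `t`. -/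
def wordOrder (e : Bool) (c : Equiv.Perm V) (f : V → Fin k) (t : V → ℕ) (u v : V) : Prop :=
  signedWord e c f u < signedWord e c f v ∨
    signedWord e c f u = signedWord e c f v ∧ t u < t v

lemma wordOrder_irrefl {f : V → Fin k} {t : V → ℕ} (u : V) : ¬ wordOrder e c f t u u := by
  rintro (h | h)
  · exact lt_irrefl _ h
  · exact lt_irrefl _ h.2

/-- Words decide every pair except possibly two fixed points, which t separates. In the reversing
case two fixed points of one colour would have to reverse their own order, hence `hfix`. -/
lemma isCompatible_wordOrder [NeZero k] {f : V → Fin k} {t : V → ℕ}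
    (hsep : ∀ u v, u ≠ v → ¬ (c u = u ∧ c v = v) → ¬ SameWord c f u v)
    (ht : ∀ u v, c u = u → c v = v → t u = t v → u = v)
    (hfix : e = false → ∀ u v, c u = u → c v = v → f u = f v → u = v) :
    IsCompatible e c univ (wordOrder e c f t) f where
  supp _ := by simp
  off h := by simp at h
  irrefl := wordOrder_irrefl
  trans {u v w} h1 h2 := by
    unfold wordOrder at *
    rcases h1 with h1 | ⟨h1, h1'⟩ <;> rcases h2 with h2 | ⟨h2, h2'⟩
    · exact Or.inl (h1.trans h2)
    · exact Or.inl (h2 ▸ h1)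
    · exact Or.inl (h1 ▸ h2)
    · exact Or.inr ⟨h1.trans h2, h1'.trans h2'⟩
  total {u v} _ _ huv := by
    unfold wordOrder
    rcases lt_trichotomy (signedWord e c f u) (signedWord e c f v) with h | h | h
    · exact Or.inl (Or.inl h)
    · have hfx : c u = u ∧ c v = v := by
        by_contra hn
        exact hsep u v huv hn (signedWord_inj h)
      rcases lt_or_gt_of_ne (fun h' => huv (ht u v hfx.1 hfx.2 h')) with h' | h'
      · exact Or.inl (Or.inr ⟨h, h'⟩)
      · exact Or.inr (Or.inr ⟨h.symm, h'⟩)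
    · exact Or.inr (Or.inl h)
  mono _ _ h := Or.inl (signedWord_lt_of_lt h)
  step {u v} _ _ heq := by
    by_cases huv : u = v
    · subst huv
      have : orient e (wordOrder e c f t) (c u) (c u) ↔ wordOrder e c f t (c u) (c u) := by
        cases e <;> simp [orient]
      rw [this]
      exact iff_of_false (wordOrder_irrefl _) (wordOrder_irrefl _)
    by_cases hfx : c u = u ∧ c v = v
    · cases e with
      | true => simp [orient, hfx.1, hfx.2]
      | false => exact absurd (hfix rfl u v hfx.1 hfx.2 heq) huv
    have hfx' : ¬ (c (c u) = c u ∧ c (c v) = c v) := by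
      rwa [c.injective.eq_iff, c.injective.eq_iff]
    have h1 : signedWord e c f u ≠ signedWord e c f v := fun h => hsep u v huv hfx (signedWord_inj h)
    have h2 : signedWord e c f (c u) ≠ signedWord e c f (c v) := fun h =>
      hsep (c u) (c v) (fun h => huv (c.injective h)) hfx' (signedWord_inj h)
    have e1 : wordOrder e c f t u v ↔ signedWord e c f u < signedWord e c f v := by
      simp [wordOrder, h1]
    have e2 : orient e (wordOrder e c f t) (c u) (c v) ↔
        orient e (· < ·) (signedWord e c f (c u)) (signedWord e c f (c v)) := by
      cases e <;> simp [orient, wordOrder, h2, h2.symm]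
    rw [e1, e2]
    refine ⟨signedWord_shift heq, fun h => ?_⟩
    by_contra hn
    have := signedWord_shift heq.symm (lt_of_le_of_ne (not_lt.1 hn) h1.symm)
    exact orient_asymm h this

section glue

variable {m : ℕ}

/-- The colouring that is `w` on the fixed points, listed by `s`, and `g` elsewhere. -/
def glueColor (c : Equiv.Perm V) (s : {v // c v = v} ≃ Fin m) (w : Fin m → Fin k)
    (g : {v // c v ≠ v} → Fin k) (v : V) : Fin k :=
  if h : c v = v then w (s ⟨v, h⟩) else g ⟨v, h⟩

/-- The position of a fixed point in the list `s`. -/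
def glueTie (c : Equiv.Perm V) (s : {v // c v = v} ≃ Fin m) (v : V) : ℕ :=
  if h : c v = v then s ⟨v, h⟩ else 0

/-- The restriction of `c` to the points that it moves. -/
def movedPerm (c : Equiv.Perm V) : Equiv.Perm {v // c v ≠ v} :=
  c.subtypePerm (p := fun v => c v ≠ v) fun v => by rw [Ne, c.injective.eq_iff]

lemma glue_separated {s : {v // c v = v} ≃ Fin m} {w : Fin m → Fin k} {g : {v // c v ≠ v} → Fin k}
    (hg : IsSeparating (movedPerm c) g) (u v : V) (huv : u ≠ v) (hfx : ¬ (c u = u ∧ c v = v)) :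
    ¬ SameWord c (glueColor c s w g) u v := by
  have moved : ∀ u v, u ≠ v → c u ≠ u → c v ≠ v → ¬ SameWord c (glueColor c s w g) u v := by
    intro u v huv hu hv hs
    have hcu : c (c u) ≠ c u := fun h => hu (c.injective h)
    have hcv : c (c v) ≠ c v := fun h => hv (c.injective h)
    have h0 := hs 0
    have h1 := hs 1
    simp only [pow_zero, Equiv.Perm.one_apply, pow_one, glueColor, dif_neg hu, dif_neg hv,
      dif_neg hcu, dif_neg hcv] at h0 h1
    exact hg ⟨u, hu⟩ ⟨v, hv⟩ (fun h => huv (congrArg Subtype.val h)) h0 h1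
  -- A fixed point has a constant word. If v shared it, then v and `c v` would have the same word,
  -- contrary to the case of two moved points.
  have half : ∀ u v, c u = u → c v ≠ v → ¬ SameWord c (glueColor c s w g) u v := by
    intro u v hu hv hs
    refine moved v (c v) (Ne.symm hv) hv (fun h => hv (c.injective h)) fun j => ?_
    have h1 := hs j
    have h2 := hs (j + 1)
    have hp : ∀ j : ℕ, (c ^ j) u = u := fun j => by
      induction j with
      | zero => simp
      | succ j ih => rw [pow_succ, Equiv.Perm.mul_apply, hu, ih]
    rw [hp] at h1 h2
    rw [pow_succ, Equiv.Perm.mul_apply] at h2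
    rw [← h1, ← h2]
  by_cases hu : c u = u
  · exact half u v hu fun hv => hfx ⟨hu, hv⟩
  · by_cases hv : c v = v
    · exact fun hs => half v u hv hu hs.symm
    · exact moved u v huv hu hv

variable [NeZero k]

lemma isCompatible_glue {s : {v // c v = v} ≃ Fin m} {w : Fin m → Fin k}
    {g : {v // c v ≠ v} → Fin k} (hw : IsFixedWord e w) (hg : IsSeparating (movedPerm c) g) :
    IsCompatible e c univ (wordOrder e c (glueColor c s w g) (glueTie c s))
      (glueColor c s w g) := by
  refine isCompatible_wordOrder (glue_separated hg) ?_ ?_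
  · intro u v hu hv h
    simp only [glueTie, dif_pos hu, dif_pos hv] at h
    exact congrArg Subtype.val (s.injective (Fin.val_injective h))
  · intro he u v hu hv h
    simp only [glueColor, dif_pos hu, dif_pos hv] at h
    exact congrArg Subtype.val (s.injective ((hw.2 he).injective h))

lemma wordOrder_glue_fixed {s : {v // c v = v} ≃ Fin m} {w : Fin m → Fin k}
    {g : {v // c v ≠ v} → Fin k} (hw : IsFixedWord e w) (hg : IsSeparating (movedPerm c) g)
    (u v : {v // c v = v}) :
    wordOrder e c (glueColor c s w g) (glueTie c s) u v ↔ s u < s v := by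
  have hcol : ∀ u : {v // c v = v}, glueColor c s w g u = w (s u) := fun u => by
    simp [glueColor, u.2]
  have htie : ∀ u : {v // c v = v}, glueTie c s u = s u := fun u => by simp [glueTie, u.2]
  have hcomp := isCompatible_glue (s := s) hw hg
  have imp : ∀ u v : {v // c v = v}, s u < s v →
      wordOrder e c (glueColor c s w g) (glueTie c s) u v := fun u v hlt => by
    rcases (hw.1 hlt.le).lt_or_eq with h | h
    · exact Or.inl (signedWord_lt_of_lt (by rwa [hcol, hcol]))
    · refine Or.inr ⟨?_, by rw [htie, htie]; exact hlt⟩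
      have hp : ∀ (u : {v // c v = v}) (j : ℕ), (c ^ j) (u : V) = u := fun u j => by
        induction j with
        | zero => simp
        | succ j ih => rw [pow_succ, Equiv.Perm.mul_apply, u.2, ih]
      unfold signedWord
      congr 1
      funext j
      rw [hp, hp, hcol, hcol, h]
  refine ⟨fun h => ?_, imp u v⟩
  by_contra hn
  rcases (not_lt.1 hn).lt_or_eq with h' | h'
  · exact hcomp.asymm h (imp v u h')
  · rw [s.injective h'] at h
    exact hcomp.irrefl _ h

-- The construction is injective: the order restricted to the fixed points recovers the listing s,
-- after which the colouring recovers w and g.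
open Classical in
lemma card_le_card_compatiblePairs :
    Fintype.card ({v // c v = v} ≃ Fin m) *
      ({w : Fin m → Fin k | IsFixedWord e w} : Finset (Fin m → Fin k)).card *
      ({g : {v // c v ≠ v} → Fin k | IsSeparating (movedPerm c) g} :
        Finset ({v // c v ≠ v} → Fin k)).card ≤ (compatiblePairs e c k univ).card := by
  rw [← Finset.card_univ, ← Finset.card_product, ← Finset.card_product]
  refine Finset.card_le_card_of_injOn (fun x => (wordOrder e c (glueColor c x.1.1 x.1.2 x.2)
    (glueTie c x.1.1), glueColor c x.1.1 x.1.2 x.2)) ?_ ?_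
  · rintro ⟨⟨s, w⟩, g⟩ hx
    simp only [Finset.mem_coe, Finset.mem_product, mem_filter, mem_univ, true_and] at hx
    exact mem_compatiblePairs.2 (isCompatible_glue hx.1 hx.2)
  · rintro ⟨⟨s, w⟩, g⟩ hx ⟨⟨s', w'⟩, g'⟩ hx' h
    simp only [Finset.mem_coe, Finset.mem_product, mem_filter, mem_univ, true_and] at hx hx'
    obtain ⟨h1, h2⟩ := Prod.ext_iff.1 h
    simp only at h1 h2
    have hs : s = s' := equiv_eq_of_lt_iff fun u v => by
      rw [← wordOrder_glue_fixed (e := e) hx.1 hx.2 u v,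
        ← wordOrder_glue_fixed (e := e) hx'.1 hx'.2 u v, h1]
    subst hs
    have hw : w = w' := by
      funext i
      have := congrFun h2 (s.symm i)
      simpa [glueColor, (s.symm i).2] using this
    have hg : g = g' := by
      funext v
      have := congrFun h2 v
      simpa [glueColor, v.2] using this
    rw [hw, hg]

theorem le_card_compatiblePairs :
    fixedCount e k (fixedNumber c) * ((k : ℝ) ^ (Fintype.card V - fixedNumber c) *
      (1 - Fintype.card V / k - (Fintype.card V : ℝ) ^ 2 / k ^ 2)) ≤
      ((compatiblePairs e c k univ).card : ℝ) := by
  classical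
  have hk : 0 < k := Nat.pos_of_ne_zero (NeZero.ne k)
  have hk' : (0 : ℝ) < k := by exact_mod_cast hk
  have hF : Fintype.card {v // c v = v} = fixedNumber c := by
    rw [fixedNumber, Fintype.card_subtype]
  have hR : Fintype.card {v // c v ≠ v} = Fintype.card V - fixedNumber c := by
    rw [← hF, ← Fintype.card_subtype_compl]
  have h := card_le_card_compatiblePairs (e := e) (k := k) (c := c) (m := fixedNumber c)
  rw [Fintype.card_equiv (Fintype.equivFinOfCardEq hF), hF, card_fixedWord] at h
  have hsep := card_separating hk (movedPerm c) (fun v h => v.2 (congrArg Subtype.val h))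
  rw [hR] at hsep
  have hle : ((Fintype.card V - fixedNumber c : ℕ) : ℝ) ≤ Fintype.card V := by
    exact_mod_cast Nat.sub_le _ _
  calc (fixedCount e k (fixedNumber c) : ℝ) * ((k : ℝ) ^ (Fintype.card V - fixedNumber c) *
      (1 - Fintype.card V / k - (Fintype.card V : ℝ) ^ 2 / k ^ 2))
      ≤ (fixedCount e k (fixedNumber c) : ℝ) * _ := by
        refine mul_le_mul_of_nonneg_left (le_trans ?_ hsep) (by positivity)
        gcongr
    _ ≤ _ := by exact_mod_cast h

end glue

end

/-! ### Averages over a conjugacy class and the generating function in k. -/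

instance permMeasurableSingletonClass (n : ℕ) : MeasurableSingletonClass (Equiv.Perm (Fin n)) :=
  ⟨fun _ => trivial⟩

lemma descentMGF_eq_sum {n : ℕ} (lam : n.Partition) (s : ℝ) :
    descentMGF lam s =
      (∑ π ∈ conjClass lam, Real.exp (s * normalizedDescent lam π)) / (conjClass lam).card := by
  classical
  unfold descentMGF ProbabilityTheory.mgf classLaw
  rw [MeasureTheory.integral_fintype (MeasureTheory.Integrable.of_finite)]
  have h : ∀ π : Equiv.Perm (Fin n),
      (ProbabilityTheory.uniformOn (conjClass lam : Set (Equiv.Perm (Fin n)))).real {π} =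
        if π ∈ conjClass lam then ((conjClass lam).card : ℝ)⁻¹ else 0 := fun π => by
    rw [MeasureTheory.Measure.real, ← Finset.coe_singleton,
      ProbabilityTheory.uniformOn_apply_finset]
    by_cases hπ : π ∈ conjClass lam
    · rw [Finset.inter_singleton_of_mem hπ]; simp [hπ]
    · rw [Finset.inter_singleton_of_notMem hπ]; simp [hπ]
  simp only [h, smul_eq_mul, ite_mul, zero_mul, Finset.sum_ite_mem, Finset.univ_inter]
  rw [← Finset.mul_sum, div_eq_inv_mul]

lemma exists_mem_conjClass {n : ℕ} (lam : n.Partition) : (conjClass lam).Nonempty := by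
  have hsplit : lam.parts = lam.parts.filter (2 ≤ ·) + lam.parts.filter (¬ 2 ≤ ·) :=
    (Multiset.filter_add_not _ _).symm
  have hone : lam.parts.filter (¬ 2 ≤ ·) =
      Multiset.replicate (lam.parts.filter (¬ 2 ≤ ·)).card 1 := by
    refine Multiset.eq_replicate_card.2 fun a ha => ?_
    obtain ⟨h1, h2⟩ := Multiset.mem_filter.1 ha
    have := lam.parts_pos h1
    omega
  have hsum : (lam.parts.filter (2 ≤ ·)).sum + (lam.parts.filter (¬ 2 ≤ ·)).card = n := by
    have h := lam.parts_sum
    rw [hsplit, Multiset.sum_add, hone, Multiset.sum_replicate] at h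
    simpa using h
  obtain ⟨g, hg⟩ := (Equiv.Perm.exists_with_cycleType_iff (Fin n)
    (m := lam.parts.filter (2 ≤ ·))).2 ⟨by rw [Fintype.card_fin]; omega, fun a ha =>
      (Multiset.mem_filter.1 ha).2⟩
  refine ⟨g, ?_⟩
  simp only [conjClass, Finset.mem_filter, Finset.mem_univ, true_and]
  rw [Equiv.Perm.parts_partition, hg, ← Equiv.Perm.sum_cycleType, hg, Fintype.card_fin]
  conv_rhs => rw [hsplit, hone]
  congr 2
  omega

lemma mem_conjClass_iff {n : ℕ} {lam : n.Partition} {c π : Equiv.Perm (Fin n)}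
    (hc : c ∈ conjClass lam) : π ∈ conjClass lam ↔ ∃ σ, σ * c * σ⁻¹ = π := by
  have hc' : c.partition.parts = lam.parts := (Finset.mem_filter.1 hc).2
  rw [← isConj_iff, Equiv.Perm.partition_eq_of_isConj, Nat.Partition.ext_iff, hc']
  simp [conjClass, eq_comm]

lemma mult_one_eq_fixedNumber {n : ℕ} {lam : n.Partition} {c : Equiv.Perm (Fin n)}
    (hc : c ∈ conjClass lam) : mult lam 1 = fixedNumber c := by
  have hc' : c.partition.parts = lam.parts := (Finset.mem_filter.1 hc).2
  rw [mult, ← hc', Equiv.Perm.parts_partition, Multiset.count_add, Multiset.count_replicate_self,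
    Multiset.count_eq_zero_of_notMem, zero_add, fixedNumber]
  · rw [← Finset.card_compl]
    congr 1
    ext v
    simp
  · intro h
    exact absurd (Equiv.Perm.one_lt_of_mem_cycleType h) (lt_irrefl 1)

/-- Averaging over a conjugacy class is averaging over all conjugates of one of its members. -/
lemma sum_conjClass {n : ℕ} {lam : n.Partition} {c : Equiv.Perm (Fin n)} (hc : c ∈ conjClass lam)
    (g : Equiv.Perm (Fin n) → ℝ) :
    (∑ π ∈ conjClass lam, g π) / (conjClass lam).card =
      (∑ σ : Equiv.Perm (Fin n), g (σ * c * σ⁻¹)) / n.factorial := by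
  have h1 : ∀ σ : Equiv.Perm (Fin n),
      ∑ π ∈ conjClass lam, g (σ * π * σ⁻¹) = ∑ π ∈ conjClass lam, g π := fun σ => by
    refine Finset.sum_bij (fun π _ => σ * π * σ⁻¹) ?_ ?_ ?_ (fun _ _ => rfl)
    · intro π hπ
      obtain ⟨τ, rfl⟩ := (mem_conjClass_iff hc).1 hπ
      exact (mem_conjClass_iff hc).2 ⟨σ * τ, by group⟩
    · intro π _ π' _ h
      simpa using h
    · intro π hπ
      obtain ⟨τ, rfl⟩ := (mem_conjClass_iff hc).1 hπ
      exact ⟨σ⁻¹ * (τ * c * τ⁻¹) * σ, (mem_conjClass_iff hc).2 ⟨σ⁻¹ * τ, by group⟩, by group⟩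
  have h2 : ∀ π ∈ conjClass lam, ∑ σ : Equiv.Perm (Fin n), g (σ * π * σ⁻¹) =
      ∑ σ : Equiv.Perm (Fin n), g (σ * c * σ⁻¹) := fun π hπ => by
    obtain ⟨τ, rfl⟩ := (mem_conjClass_iff hc).1 hπ
    refine Fintype.sum_equiv (Equiv.mulRight τ) _ _ fun σ => ?_
    congr 1
  have h3 : (n.factorial : ℝ) * ∑ π ∈ conjClass lam, g π =
      (conjClass lam).card * ∑ σ : Equiv.Perm (Fin n), g (σ * c * σ⁻¹) := by
    calc (n.factorial : ℝ) * ∑ π ∈ conjClass lam, g π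
        = ∑ σ : Equiv.Perm (Fin n), ∑ π ∈ conjClass lam, g (σ * π * σ⁻¹) := by
          simp [h1, Fintype.card_perm]
      _ = ∑ π ∈ conjClass lam, ∑ σ : Equiv.Perm (Fin n), g (σ * π * σ⁻¹) := Finset.sum_comm
      _ = _ := by rw [Finset.sum_congr rfl h2]; simp
  have h4 : ((conjClass lam).card : ℝ) ≠ 0 := by
    exact_mod_cast (Finset.card_pos.2 ⟨c, hc⟩).ne'
  have h5 : (n.factorial : ℝ) ≠ 0 := by exact_mod_cast n.factorial_ne_zero
  rw [div_eq_div_iff h4 h5]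
  linarith

lemma hasSum_choose_shift {n q : ℕ} (hq : q ≤ n) {t : ℝ} (ht0 : 0 ≤ t) (ht1 : t < 1) :
    HasSum (fun k : ℕ => t ^ (k + 1) * ((k + 1 + q).choose (n + 1) : ℝ))
      (t ^ (n + 1 - q) / (1 - t) ^ (n + 2)) := by
  -- The first n - q binomial coefficients vanish; from there on the series is the standard negative
  -- binomial one.
  rw [← hasSum_nat_add_iff' (n - q)]
  have hz : ∑ i ∈ range (n - q), t ^ (i + 1) * ((i + 1 + q).choose (n + 1) : ℝ) = 0 := by
    refine Finset.sum_eq_zero fun i hi => ?_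
    rw [Nat.choose_eq_zero_of_lt (by have := Finset.mem_range.1 hi; omega)]
    simp
  rw [hz, sub_zero]
  have h := (hasSum_choose_mul_geometric_of_norm_lt_one (𝕜 := ℝ) (n + 1) (r := t)
    (by rwa [Real.norm_of_nonneg ht0])).mul_left (t ^ (n + 1 - q))
  convert! h using 1
  · funext k
    rw [show k + (n - q) + 1 + q = k + (n + 1) by omega,
      show k + (n - q) + 1 = (n + 1 - q) + k by omega, pow_add]
    ring
  · ring

lemma weakSteps_le {n : ℕ} (e : Bool) (π : Equiv.Perm (Fin (n + 1))) : weakSteps e π ≤ n := by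
  have := descentNumber_le π
  unfold weakSteps
  split_ifs <;> omega

/-- The probability that a random colouring with `k` colours is compatible with a random
ordering, relative to the largest possible value. -/
noncomputable def compatibleRatio {n : ℕ} (e : Bool) (c : Equiv.Perm (Fin (n + 1))) (k : ℕ) : ℝ :=
  (∑ σ : Equiv.Perm (Fin (n + 1)), ((k + weakSteps e (σ * c * σ⁻¹)).choose (n + 1) : ℝ)) /
    k.ascFactorial (n + 1)

lemma compatibleRatio_nonneg {n : ℕ} (e : Bool) (c : Equiv.Perm (Fin (n + 1))) (k : ℕ) :
    0 ≤ compatibleRatio e c k := by unfold compatibleRatio; positivity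

lemma compatibleRatio_le_one {n : ℕ} (e : Bool) (c : Equiv.Perm (Fin (n + 1))) (k : ℕ) :
    compatibleRatio e c k ≤ 1 := by
  refine div_le_one_of_le₀ ?_ (by positivity)
  rw [Nat.ascFactorial_eq_factorial_mul_choose']
  calc (∑ σ : Equiv.Perm (Fin (n + 1)), ((k + weakSteps e (σ * c * σ⁻¹)).choose (n + 1) : ℝ))
      ≤ ∑ _σ : Equiv.Perm (Fin (n + 1)), ((k + (n + 1) - 1).choose (n + 1) : ℝ) := by
        refine Finset.sum_le_sum fun σ _ => ?_
        have := weakSteps_le e (σ * c * σ⁻¹)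
        exact_mod_cast Nat.choose_le_choose _ (by omega)
    _ = _ := by simp [Fintype.card_perm]

/-- The binomial weight cancels the rising factorial in `compatibleRatio` up to (n+1)!, so each term
is t^(k+1) times the number of compatible pairs with k + 1 colours over (n+1)!. -/
lemma hasSum_compatibleRatio {n : ℕ} (e : Bool) (c : Equiv.Perm (Fin (n + 1))) {t : ℝ}
    (ht0 : 0 ≤ t) (ht1 : t < 1) :
    HasSum (fun k : ℕ => t ^ (k + 1) * ((k + 1 + n).choose (n + 1) : ℝ) *
        compatibleRatio e c (k + 1))
      ((∑ σ : Equiv.Perm (Fin (n + 1)), t ^ (n + 1 - weakSteps e (σ * c * σ⁻¹))) /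
        (n + 1).factorial / (1 - t) ^ (n + 2)) := by
  have h := (hasSum_sum (s := (univ : Finset (Equiv.Perm (Fin (n + 1))))) fun σ _ =>
    hasSum_choose_shift (weakSteps_le e (σ * c * σ⁻¹)) ht0 ht1).div_const ((n + 1).factorial : ℝ)
  convert! h using 1
  · funext k
    unfold compatibleRatio
    rw [Nat.ascFactorial_eq_factorial_mul_choose', ← Finset.mul_sum]
    have h1 : ((k + 1 + (n + 1) - 1).choose (n + 1) : ℝ) ≠ 0 := by
      exact_mod_cast (Nat.choose_pos (by omega)).ne'
    have h2 : ((n + 1).factorial : ℝ) ≠ 0 := by exact_mod_cast (n + 1).factorial_ne_zero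
    rw [show k + 1 + n = k + 1 + (n + 1) - 1 by omega]
    push_cast
    field_simp
  · rw [← Finset.sum_div, div_right_comm]

/-- The sign attached to an orientation. -/
def sgn (e : Bool) : ℝ := if e then 1 else -1

/-- The moment generating function as a negative binomial average of `compatibleRatio`. -/
theorem descentMGF_eq_tsum {n : ℕ} {lam : (n + 1).Partition} {c : Equiv.Perm (Fin (n + 1))}
    (hc : c ∈ conjClass lam) (e : Bool) {τ : ℝ} (hτ : 0 < τ) :
    descentMGF lam (-(sgn e * (τ * Real.sqrt ((n + 1 : ℕ) : ℝ)))) =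
      Real.exp (sgn e * τ) * (Real.exp (τ * (((n + 1 : ℕ) : ℝ) + 1) / 2 -
          sgn e * τ * (fixedNumber c : ℝ) ^ 2 / (2 * ((n + 1 : ℕ) : ℝ))) *
        ((1 - Real.exp (-τ)) ^ (n + 2) * ∑' k : ℕ, Real.exp (-τ) ^ (k + 1) *
          ((k + 1 + n).choose (n + 1) : ℝ) * compatibleRatio e c (k + 1))) := by
  set t := Real.exp (-τ) with ht
  have ht0 : 0 ≤ t := (Real.exp_pos _).le
  have ht1 : t < 1 := by rw [ht, Real.exp_lt_one_iff]; linarith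
  rw [(hasSum_compatibleRatio e c ht0 ht1).tsum_eq, mul_div_cancel₀ _ (by
    have : (0 : ℝ) < 1 - t := by linarith
    positivity), descentMGF_eq_sum, sum_conjClass hc, ← mul_div_assoc, ← mul_div_assoc,
    Finset.mul_sum, Finset.mul_sum]
  congr 1
  refine Finset.sum_congr rfl fun σ _ => ?_
  set π := σ * c * σ⁻¹
  have hN : (0 : ℝ) < ((n + 1 : ℕ) : ℝ) := by positivity
  have hsq : Real.sqrt ((n + 1 : ℕ) : ℝ) ≠ 0 := (Real.sqrt_pos.2 hN).ne'
  have hd := descentNumber_le π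
  have hdR : ((n + 1 - weakSteps e π : ℕ) : ℝ) =
      ((n + 1 : ℕ) : ℝ) / 2 + 1 / 2 + sgn e * (descentNumber π - (n : ℝ) / 2) := by
    cases e with
    | true =>
      rw [weakSteps, if_pos rfl, show n + 1 - (n - descentNumber π) = descentNumber π + 1 by omega]
      simp only [sgn, if_true]; push_cast; ring
    | false =>
      rw [weakSteps, if_neg (by simp), Nat.cast_sub (by omega)]
      simp only [sgn, Bool.false_eq_true, if_false]; push_cast; ring
  rw [ht, ← Real.exp_nat_mul, ← Real.exp_add, ← Real.exp_add, hdR, normalizedDescent,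
    mult_one_eq_fixedNumber hc]
  congr 1
  have hs2 : sgn e * sgn e = 1 := by cases e <;> simp [sgn]
  field_simp
  push_cast
  ring

/-! ### Second-order asymptotics of `compatibleRatio`. -/

lemma abs_log_one_add_sub_le {x : ℝ} (hx : |x| ≤ 1 / 2) :
    |Real.log (1 + x) - (x - x ^ 2 / 2)| ≤ 2 * |x| ^ 3 := by
  have h := Real.abs_log_sub_add_sum_range_le (x := -x) (by rw [abs_neg]; linarith) 2
  rw [abs_neg, sub_neg_eq_add] at h
  have h1 : (∑ i ∈ range 2, (-x) ^ (i + 1) / ((i : ℝ) + 1)) + Real.log (1 + x) =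
      Real.log (1 + x) - (x - x ^ 2 / 2) := by
    simp [Finset.sum_range_succ]; ring
  rw [h1] at h
  refine h.trans ?_
  rw [div_le_iff₀ (by linarith)]
  have : 0 ≤ |x| ^ 3 := by positivity
  norm_num
  nlinarith

/-- This gives the logarithm of a rising or falling factorial over a power of k, with u = 1/k. When
Nu = O(τ) the error is O((1 + Nτ²)τ), so two orders of the expansion suffice. -/
lemma sum_log_one_add_estimate (ε u : ℝ) (hε : ε ^ 2 = 1) (hu : 0 ≤ u) (N m : ℕ) (hmN : m ≤ N)
    (hN : N * u ≤ 1 / 2) :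
    |∑ j ∈ range m, Real.log (1 + ε * j * u) - (ε * m ^ 2 * u / 2 - m ^ 3 * u ^ 2 / 6)| ≤
      N * u / 2 + (N * u) ^ 2 + 2 * N * (N * u) ^ 3 := by
  have hεabs : |ε| = 1 := by
    have : |ε| ^ 2 = 1 := by rw [sq_abs, hε]
    nlinarith [abs_nonneg ε]
  have hterm : ∀ j ∈ range m, |Real.log (1 + ε * j * u) - (ε * j * u - (j * u) ^ 2 / 2)| ≤
      2 * (N * u) ^ 3 := fun j hj => by
    have hj' : (j : ℝ) ≤ N := by exact_mod_cast (Finset.mem_range.1 hj).le.trans hmN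
    have habs : |ε * j * u| = j * u := by
      rw [abs_mul, abs_mul, hεabs, abs_of_nonneg hu, Nat.abs_cast, one_mul]
    have hju : (j : ℝ) * u ≤ N * u := mul_le_mul_of_nonneg_right hj' hu
    have h := abs_log_one_add_sub_le (x := ε * j * u) (by rw [habs]; linarith)
    rw [habs, show (ε * j * u) ^ 2 = (j * u) ^ 2 by
      rw [mul_assoc, mul_pow, hε, one_mul]] at h
    refine h.trans ?_
    gcongr
  have hexact : ∀ m : ℕ, ∑ j ∈ range m, (ε * j * u - (j * u) ^ 2 / 2) =
      (ε * m ^ 2 * u / 2 - m ^ 3 * u ^ 2 / 6) - ε * (m * u) / 2 + (m * u) ^ 2 / 4 -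
        m * u ^ 2 / 12 := fun m => by
    induction m with
    | zero => simp
    | succ m ih => rw [Finset.sum_range_succ, ih]; push_cast; ring
  have hsum : |∑ j ∈ range m, Real.log (1 + ε * j * u) -
      ∑ j ∈ range m, (ε * j * u - (j * u) ^ 2 / 2)| ≤ 2 * N * (N * u) ^ 3 := by
    rw [← Finset.sum_sub_distrib]
    refine (Finset.abs_sum_le_sum_abs _ _).trans ((Finset.sum_le_sum hterm).trans ?_)
    simp only [Finset.sum_const, Finset.card_range, nsmul_eq_mul]
    have : (m : ℝ) ≤ N := by exact_mod_cast hmN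
    have h3 : 0 ≤ 2 * (N * u) ^ 3 := by positivity
    nlinarith
  rw [hexact] at hsum
  have hm : (m : ℝ) ≤ N := by exact_mod_cast hmN
  have hmu : (m : ℝ) * u ≤ N * u := mul_le_mul_of_nonneg_right hm hu
  have hmu0 : 0 ≤ (m : ℝ) * u := by positivity
  have hsq : ((m : ℝ) * u) ^ 2 ≤ (N * u) ^ 2 := by gcongr
  have hmm : (m : ℝ) * u ^ 2 ≤ (N * u) ^ 2 := by
    refine le_trans ?_ hsq
    rw [mul_pow]
    refine mul_le_mul_of_nonneg_right ?_ (by positivity)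
    exact_mod_cast Nat.le_self_pow two_ne_zero m
  have hm2 : 0 ≤ (m : ℝ) * u ^ 2 := by positivity
  have heps : |ε * (m * u) / 2| ≤ N * u / 2 := by
    rw [abs_div, abs_mul, hεabs, one_mul, abs_of_nonneg hmu0, abs_two]; linarith
  rw [abs_le] at hsum heps ⊢
  constructor <;> nlinarith [hsum.1, hsum.2, heps.1, heps.2]

lemma cast_ascFactorial_eq (k m : ℕ) (hk : 0 < k) :
    (k.ascFactorial m : ℝ) = (k : ℝ) ^ m *
      Real.exp (∑ j ∈ range m, Real.log (1 + 1 * j * (1 / (k : ℝ)))) := by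
  have hk' : (0 : ℝ) < k := by exact_mod_cast hk
  induction m with
  | zero => simp
  | succ m ih =>
    rw [Nat.ascFactorial_succ, Finset.sum_range_succ, Real.exp_add, Real.exp_log (by positivity)]
    push_cast
    rw [ih]
    field_simp
    ring

lemma cast_descFactorial_eq (k m : ℕ) (hk : 0 < k) (hmk : m ≤ k) :
    (k.descFactorial m : ℝ) = (k : ℝ) ^ m *
      Real.exp (∑ j ∈ range m, Real.log (1 + (-1) * j * (1 / (k : ℝ)))) := by
  have hk' : (0 : ℝ) < k := by exact_mod_cast hk
  induction m with
  | zero => simp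
  | succ m ih =>
    have hm : (m : ℝ) < k := by exact_mod_cast hmk
    have hpos : 0 < 1 + (-1) * (m : ℝ) * (1 / (k : ℝ)) := by
      have : (m : ℝ) / k < 1 := by rwa [div_lt_one hk']
      have e : 1 + (-1) * (m : ℝ) * (1 / (k : ℝ)) = 1 - m / k := by ring
      rw [e]; linarith
    rw [Nat.descFactorial_succ, Finset.sum_range_succ, Real.exp_add, Real.exp_log hpos]
    push_cast [Nat.cast_sub (show m ≤ k by omega)]
    rw [ih (by omega)]
    field_simp
    ring

lemma cast_fixedCount_eq (e : Bool) (k m : ℕ) (hk : 0 < k) (hmk : m ≤ k) :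
    (fixedCount e k m : ℝ) = (k : ℝ) ^ m *
      Real.exp (∑ j ∈ range m, Real.log (1 + sgn e * j * (1 / (k : ℝ)))) := by
  cases e with
  | true => simpa only [fixedCount, sgn, if_true] using cast_ascFactorial_eq k m hk
  | false =>
    simpa only [fixedCount, sgn, Bool.false_eq_true, if_false] using cast_descFactorial_eq k m hk hmk

lemma sgn_sq (e : Bool) : sgn e ^ 2 = 1 := by cases e <;> simp [sgn]

lemma exp_neg_two_mul_le {y : ℝ} (h0 : 0 ≤ y) (h1 : y ≤ 1 / 2) : Real.exp (-(2 * y)) ≤ 1 - y := by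
  rw [Real.exp_neg, inv_le_comm₀ (Real.exp_pos _) (by linarith)]
  have h := Real.add_one_le_exp (2 * y)
  refine le_trans ?_ h
  rw [inv_le_iff_one_le_mul₀ (by linarith)]
  nlinarith

/-- The exponent of the leading factor of `compatibleRatio` at `x = k τ / N`. -/
noncomputable def rate (N τ p r x : ℝ) : ℝ := -(N * τ * p / x) + N * τ ^ 2 * r / (2 * x ^ 2)

/-- The powers of k cancel, and L is the difference of the log-sums for m and for N. Its 1/k and
1/k² terms are the two terms of `rate`. -/
lemma leading_estimate (e : Bool) {n m k : ℕ} (hk : 0 < k) (hmN : m ≤ n + 1) {τ N α x : ℝ}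
    (hτ : 0 < τ) (hτ1 : τ ≤ 1 / 16) (hN : N = ((n + 1 : ℕ) : ℝ)) (hα : α = m / N)
    (hx : x = k * τ / N) (hNu : N / k ≤ 2 * τ) :
    ∃ L : ℝ, (fixedCount e k m : ℝ) * (k : ℝ) ^ (n + 1 - m) / k.ascFactorial (n + 1) = Real.exp L ∧
      |L - rate N τ ((1 - sgn e * α ^ 2) / 2) ((1 - α ^ 3) / 3) x| ≤
        (3 + 32 * (N * τ ^ 2)) * τ := by
  have hk' : (0 : ℝ) < k := by exact_mod_cast hk
  have hNpos : 0 < N := by rw [hN]; positivity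
  obtain ⟨u, hu⟩ : ∃ u : ℝ, u = 1 / k := ⟨_, rfl⟩
  have hu0 : 0 ≤ u := by rw [hu]; positivity
  rw [div_eq_mul_one_div, ← hu] at hNu
  have hNu0 : 0 ≤ N * u := by positivity
  have hNk : n + 1 ≤ k := by
    have h1 : N * u ≤ 1 := by linarith
    rw [hu, mul_one_div, div_le_one hk', hN] at h1
    exact_mod_cast h1
  have hasc := cast_ascFactorial_eq k (n + 1) hk
  have hfix := cast_fixedCount_eq e k m hk (hmN.trans hNk)
  have hea := sum_log_one_add_estimate 1 u (by norm_num) hu0 (n + 1) (n + 1) le_rfl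
    (by rw [← hN]; linarith)
  have hem := sum_log_one_add_estimate (sgn e) u (sgn_sq e) hu0 (n + 1) m hmN
    (by rw [← hN]; linarith)
  rw [← hu] at hasc hfix
  generalize ∑ j ∈ range (n + 1), Real.log (1 + 1 * j * u) = La at hasc hea
  generalize ∑ j ∈ range m, Real.log (1 + sgn e * j * u) = Lm at hfix hem
  rw [← hN] at hea hem
  refine ⟨Lm - La, ?_, ?_⟩
  · have hpow : (k : ℝ) ^ (n + 1) = (k : ℝ) ^ m * (k : ℝ) ^ (n + 1 - m) := by
      rw [← pow_add, Nat.add_sub_cancel' hmN]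
    rw [hfix, hasc, hpow, Real.exp_sub]; field_simp
  have hrate : rate N τ ((1 - sgn e * α ^ 2) / 2) ((1 - α ^ 3) / 3) x =
      (sgn e * m ^ 2 * u / 2 - m ^ 3 * u ^ 2 / 6) - (1 * N ^ 2 * u / 2 - N ^ 3 * u ^ 2 / 6) := by
    rw [rate, hα, hx, hu]
    field_simp
    ring
  have herr : N * u / 2 + (N * u) ^ 2 + 2 * N * (N * u) ^ 3 ≤
      τ + 4 * τ ^ 2 + 16 * (N * τ ^ 2) * τ := by
    have h2 : (N * u) ^ 2 ≤ (2 * τ) ^ 2 := by gcongr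
    have h4 : 2 * N * (N * u) ^ 3 ≤ 2 * N * (2 * τ) ^ 3 := by gcongr
    linarith [h2, h4, hNu]
  have hsq : τ ^ 2 ≤ 1 / 16 * τ := by rw [sq]; gcongr
  rw [hrate, abs_le]
  rw [abs_le] at hea hem
  constructor <;> linarith [hea.1, hea.2, hem.1, hem.2]

lemma sum_choose_eq_card {n : ℕ} (e : Bool) (c : Equiv.Perm (Fin (n + 1))) {k : ℕ} [NeZero k] :
    (∑ σ : Equiv.Perm (Fin (n + 1)), ((k + weakSteps e (σ * c * σ⁻¹)).choose (n + 1) : ℝ)) =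
      ((compatiblePairs e c k univ).card : ℝ) := by
  rw [card_compatiblePairs_eq_sum_choose]; push_cast; rfl

theorem compatibleRatio_bounds {n : ℕ} (e : Bool) (c : Equiv.Perm (Fin (n + 1))) {k : ℕ}
    (hk : 0 < k) {τ N α x : ℝ} (hτ : 0 < τ) (hτ1 : τ ≤ 1 / 16) (hN : N = ((n + 1 : ℕ) : ℝ))
    (hα : α = fixedNumber c / N) (hx : x = k * τ / N) (hx1 : 1 / 2 ≤ x) :
    Real.exp (rate N τ ((1 - sgn e * α ^ 2) / 2) ((1 - α ^ 3) / 3) x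
        - (9 + 32 * (N * τ ^ 2)) * τ) ≤ compatibleRatio e c k ∧
    compatibleRatio e c k ≤ Real.exp (rate N τ ((1 - sgn e * α ^ 2) / 2) ((1 - α ^ 3) / 3) x
        + (9 + 32 * (N * τ ^ 2)) * τ) := by
  have hk' : (0 : ℝ) < k := by exact_mod_cast hk
  have hNpos : 0 < N := by rw [hN]; positivity
  have hmN : fixedNumber c ≤ n + 1 :=
    (Finset.card_le_univ _).trans_eq (Fintype.card_fin _)
  have hNu : N / k ≤ 2 * τ := by
    rw [div_le_iff₀ hk']
    rw [hx, le_div_iff₀ hNpos] at hx1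
    linarith
  have hNu0 : 0 ≤ N / k := by positivity
  have hNu2 : N ^ 2 / k ^ 2 ≤ (2 * τ) ^ 2 := by rw [← div_pow]; gcongr
  have hsq : τ ^ 2 ≤ 1 / 16 * τ := by rw [sq]; gcongr
  have hNeZ : NeZero k := ⟨hk.ne'⟩
  obtain ⟨L, hL, hdiff⟩ := leading_estimate e hk hmN hτ hτ1 hN hα hx hNu
  generalize rate N τ ((1 - sgn e * α ^ 2) / 2) ((1 - α ^ 3) / 3) x = R at hdiff ⊢
  rw [abs_le] at hdiff
  have hlow := le_card_compatiblePairs (e := e) (k := k) (c := c)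
  have hup := card_compatiblePairs_le (e := e) (k := k) (c := c)
  rw [← sum_choose_eq_card, Fintype.card_fin, ← hN] at hlow hup
  rw [mul_pow, ← Real.exp_nat_mul] at hup
  have hasc : (0 : ℝ) < k.ascFactorial (n + 1) := by
    exact_mod_cast Nat.pos_of_ne_zero fun h => by
      have := cast_ascFactorial_eq k (n + 1) hk
      rw [h] at this
      have h2 : (0 : ℝ) < (k : ℝ) ^ (n + 1) *
        Real.exp (∑ j ∈ range (n + 1), Real.log (1 + 1 * j * (1 / (k : ℝ)))) := by positivity
      rw [← this] at h2
      simp at h2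
  constructor
  · have hfac : Real.exp (-(6 * τ)) ≤ 1 - N / k - N ^ 2 / k ^ 2 := by
      have := exp_neg_two_mul_le (y := 3 * τ) (by positivity) (by linarith)
      rw [show 2 * (3 * τ) = 6 * τ by ring] at this
      linarith
    calc Real.exp (R - (9 + 32 * (N * τ ^ 2)) * τ) ≤ Real.exp (L + -(6 * τ)) := by
          apply Real.exp_le_exp.2; linarith [hdiff.1]
      _ = Real.exp L * Real.exp (-(6 * τ)) := Real.exp_add _ _
      _ ≤ Real.exp L * (1 - N / k - N ^ 2 / k ^ 2) :=
          mul_le_mul_of_nonneg_left hfac (Real.exp_pos _).le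
      _ = (fixedCount e k (fixedNumber c) : ℝ) * ((k : ℝ) ^ (n + 1 - fixedNumber c) *
            (1 - N / k - N ^ 2 / k ^ 2)) / k.ascFactorial (n + 1) := by rw [← hL]; ring
      _ ≤ compatibleRatio e c k := div_le_div_of_nonneg_right hlow hasc.le
  · have hfac : Real.exp (((n + 1 - fixedNumber c : ℕ) : ℝ) * (1 / k + 2 * N / k ^ 2)) ≤
        Real.exp (6 * τ) := by
      apply Real.exp_le_exp.2
      have h1 : ((n + 1 - fixedNumber c : ℕ) : ℝ) ≤ N := by rw [hN]; exact_mod_cast Nat.sub_le _ _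
      calc ((n + 1 - fixedNumber c : ℕ) : ℝ) * (1 / k + 2 * N / k ^ 2)
          ≤ N * (1 / k + 2 * N / k ^ 2) := mul_le_mul_of_nonneg_right h1 (by positivity)
        _ = N / k + 2 * (N ^ 2 / k ^ 2) := by ring
        _ ≤ 6 * τ := by linarith
    calc compatibleRatio e c k
        ≤ (fixedCount e k (fixedNumber c) : ℝ) * ((k : ℝ) ^ (n + 1 - fixedNumber c) *
            Real.exp (6 * τ)) / k.ascFactorial (n + 1) := by
          refine div_le_div_of_nonneg_right (hup.trans ?_) hasc.le
          gcongr
      _ = Real.exp L * Real.exp (6 * τ) := by rw [← hL]; ring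
      _ = Real.exp (L + 6 * τ) := (Real.exp_add _ _).symm
      _ ≤ _ := by apply Real.exp_le_exp.2; linarith [hdiff.2]

/-! ### Moments of the negative binomial weights and the tangent line of `rate`. -/

/-- Negative binomial weights. -/
noncomputable def weight (n : ℕ) (t : ℝ) (k : ℕ) : ℝ :=
  t ^ (k + 1) * ((k + 1 + n).choose (n + 1) : ℝ)

lemma weight_nonneg (n : ℕ) {t : ℝ} (ht : 0 ≤ t) (k : ℕ) : 0 ≤ weight n t k := by
  unfold weight; positivity

lemma hasSum_weight (n : ℕ) {t : ℝ} (ht0 : 0 ≤ t) (ht1 : t < 1) :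
    HasSum (weight n t) (t / (1 - t) ^ (n + 2)) := by
  have h := hasSum_choose_shift (le_refl n) ht0 ht1
  rwa [Nat.add_sub_cancel_left, pow_one] at h

lemma choose_mul_add (n k : ℕ) :
    ((k + 1 + n).choose (n + 1) : ℝ) * ((k + 1 : ℕ) + (n + 1 : ℕ) : ℝ) =
      ((n + 2 : ℕ) : ℝ) * ((k + 1 + (n + 1)).choose (n + 2) : ℝ) := by
  have h := Nat.add_one_mul_choose_eq (k + 1 + n) (n + 1)
  have h' : (((k + 1 + n + 1) * (k + 1 + n).choose (n + 1) : ℕ) : ℝ) =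
    (((k + 1 + n + 1).choose (n + 1 + 1) * (n + 1 + 1) : ℕ) : ℝ) := by rw [h]
  push_cast at h' ⊢
  rw [show k + 1 + (n + 1) = k + 1 + n + 1 by ring, show n + 2 = n + 1 + 1 by ring]
  linarith

/-- Multiplying a weight by k + n + 2 raises its index n by one (`choose_mul_add`). The square is
expanded in the rising products of k + n + 2, whose sums are therefore explicit. -/
lemma hasSum_weight_mul_sq (n : ℕ) {t : ℝ} (ht0 : 0 ≤ t) (ht1 : t < 1) (κ : ℝ) :
    HasSum (fun k => weight n t k * (((k + 1 : ℕ) : ℝ) - κ) ^ 2)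
      (t / (1 - t) ^ (n + 2) *
        ((((n + 2 : ℕ) : ℝ) / (1 - t) - (((n + 1 : ℕ) : ℝ) + κ)) ^ 2 +
          ((n + 2 : ℕ) : ℝ) / (1 - t) ^ 2 - ((n + 2 : ℕ) : ℝ) / (1 - t))) := by
  have hv : (0 : ℝ) < 1 - t := by linarith
  have h0 := hasSum_weight n ht0 ht1
  have h1 := (hasSum_weight (n + 1) ht0 ht1).mul_left ((n + 2 : ℕ) : ℝ)
  have h2 := (hasSum_weight (n + 2) ht0 ht1).mul_left (((n + 2 : ℕ) : ℝ) * ((n + 3 : ℕ) : ℝ))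
  have h := (h2.add (h1.mul_left (-(2 * (((n + 1 : ℕ) : ℝ) + κ) + 1)))).add
    (h0.mul_left ((((n + 1 : ℕ) : ℝ) + κ) ^ 2))
  convert! h using 1
  · funext k
    have e1 := choose_mul_add n k
    have e2 := choose_mul_add (n + 1) k
    unfold weight
    have e3 : ((n + 2 : ℕ) : ℝ) * ((n + 3 : ℕ) : ℝ) *
        ((k + 1 + (n + 2)).choose (n + 3) : ℝ) =
        ((k + 1 + n).choose (n + 1) : ℝ) * ((k + 1 : ℕ) + (n + 1 : ℕ) : ℝ) *
          ((k + 1 : ℕ) + (n + 2 : ℕ) : ℝ) := by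
      rw [e1, mul_assoc, mul_assoc, e2]
    calc t ^ (k + 1) * ((k + 1 + n).choose (n + 1) : ℝ) * (((k + 1 : ℕ) : ℝ) - κ) ^ 2
        = t ^ (k + 1) * (((k + 1 + n).choose (n + 1) : ℝ) * ((k + 1 : ℕ) + (n + 1 : ℕ) : ℝ) *
            ((k + 1 : ℕ) + (n + 2 : ℕ) : ℝ)) + -(2 * (((n + 1 : ℕ) : ℝ) + κ) + 1) *
            (t ^ (k + 1) * (((k + 1 + n).choose (n + 1) : ℝ) * ((k + 1 : ℕ) + (n + 1 : ℕ) : ℝ))) +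
            (((n + 1 : ℕ) : ℝ) + κ) ^ 2 * (t ^ (k + 1) * ((k + 1 + n).choose (n + 1) : ℝ)) := by
          push_cast; ring
      _ = _ := by rw [← e3, e1]; ring
  · rw [show n + 2 + 2 = n + 2 + 1 + 1 by ring, show n + 1 + 2 = n + 2 + 1 by ring, pow_succ,
      pow_succ]
    field_simp
    push_cast
    ring

lemma one_sub_exp_neg_bounds {θ : ℝ} (h0 : 0 < θ) (h1 : θ ≤ 1) :
    θ * (1 - θ / 2) ≤ 1 - Real.exp (-θ) ∧ 1 - Real.exp (-θ) ≤ θ := by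
  constructor
  · have h := Real.quadratic_le_exp_of_nonneg h0.le
    rw [Real.exp_neg]
    have hpos : 0 < Real.exp θ := Real.exp_pos θ
    have : (Real.exp θ)⁻¹ ≤ 1 - θ * (1 - θ / 2) := by
      rw [inv_le_iff_one_le_mul₀ hpos]
      have h2 : (0 : ℝ) ≤ 1 - θ * (1 - θ / 2) := by nlinarith
      nlinarith [mul_le_mul_of_nonneg_left h h2, sq_nonneg θ, sq_nonneg (θ ^ 2)]
    linarith
  · have := Real.add_one_le_exp (-θ); linarith

section tilt

variable {N τ p r : ℝ}

/-- The left side is the mean of (x - 1)² under the tilted law: a bias of O(τ + 1/N), squared, plus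
a variance of O(1/N). -/
lemma second_moment_le {θ β : ℝ} (hN : 1 ≤ N) (hτ : 0 < τ) (hτ1 : τ ≤ 1 / 16)
    (hβ0 : 0 ≤ β) (hβ : β ≤ τ) (hθ : θ = τ * (1 - β)) :
    (((N + 1) / (1 - Real.exp (-θ)) - (N + N / τ)) ^ 2 + (N + 1) / (1 - Real.exp (-θ)) ^ 2 -
      (N + 1) / (1 - Real.exp (-θ))) / (N / τ) ^ 2 ≤ 18 * τ ^ 2 + 12 / N := by
  have hN0 : 0 < N := by linarith
  have hθ0 : 0 < θ := by rw [hθ]; apply mul_pos hτ; linarith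
  have hθτ : θ ≤ τ := by rw [hθ]; nlinarith
  obtain ⟨hv1, hv2⟩ := one_sub_exp_neg_bounds hθ0 (by linarith)
  set v := 1 - Real.exp (-θ) with hv
  have hvpos : 0 < v := lt_of_lt_of_le (by nlinarith) hv1
  have hlow : 1 ≤ τ / v := by rw [one_le_div hvpos]; linarith
  have hup : τ / v ≤ 1 + 4 * τ := by
    rw [div_le_iff₀ hvpos]
    have h1 : τ * (1 - τ) * (1 - τ / 2) ≤ v := by
      refine le_trans ?_ hv1
      rw [hθ] at hθτ ⊢
      have a1 : τ * (1 - τ) ≤ τ * (1 - β) := by gcongr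
      have a2 : 1 - τ / 2 ≤ 1 - τ * (1 - β) / 2 := by linarith
      exact mul_le_mul a1 a2 (by linarith) (by nlinarith)
    have h2 : τ ≤ (1 + 4 * τ) * (τ * (1 - τ) * (1 - τ / 2)) := by
      have : 1 ≤ (1 + 4 * τ) * ((1 - τ) * (1 - τ / 2)) := by nlinarith [sq_nonneg τ]
      nlinarith
    nlinarith
  have hNinv : 0 < 1 / N := by positivity
  have hNinv1 : 1 / N ≤ 1 := by rw [div_le_one hN0]; exact hN
  set y := τ / v with hy
  have e1 : (((N + 1) / v - (N + N / τ)) ^ 2 + (N + 1) / v ^ 2 - (N + 1) / v) / (N / τ) ^ 2 =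
      (y * (1 + 1 / N) - τ - 1) ^ 2 + y ^ 2 * (1 / N) * (1 + 1 / N) -
        y * τ * (1 / N) * (1 + 1 / N) := by
    rw [hy]; field_simp
    ring
  rw [e1]
  have hD : (y * (1 + 1 / N) - τ - 1) ^ 2 ≤ (3 * τ + 2 * (1 / N)) ^ 2 := by
    apply sq_le_sq'
    · nlinarith
    · nlinarith
  have hD2 : (3 * τ + 2 * (1 / N)) ^ 2 ≤ 18 * τ ^ 2 + 8 * (1 / N) := by
    nlinarith [sq_nonneg (3 * τ - 2 * (1 / N))]
  have hy2 : y ^ 2 ≤ (5 / 4) ^ 2 := by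
    have : y ≤ 5 / 4 := by linarith
    gcongr
  have hE : y ^ 2 * (1 / N) * (1 + 1 / N) ≤ 4 * (1 / N) := by
    have : y ^ 2 * (1 + 1 / N) ≤ (5 / 4) ^ 2 * 2 := by
      apply mul_le_mul hy2 (by linarith) (by positivity) (by positivity)
    nlinarith
  have hF : 0 ≤ y * τ * (1 / N) * (1 + 1 / N) := by positivity
  have : 12 / N = 12 * (1 / N) := by ring
  rw [this]
  linarith

lemma rate_tangent {x : ℝ} (hN : 0 < N) (hτ : 0 < τ) (hτ1 : τ ≤ 1 / 16) (hr0 : 0 ≤ r) (hrp : r ≤ p)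
    (hp : p ≤ 1) (hx : 1 / 2 ≤ x) :
    rate N τ p r x ≤ rate N τ p r 1 + N * (τ * p - τ ^ 2 * r) * (x - 1) ∧
    rate N τ p r 1 + N * (τ * p - τ ^ 2 * r) * (x - 1) - 2 * N * τ * (x - 1) ^ 2 ≤
      rate N τ p r x := by
  have hx0 : 0 < x := by linarith
  have hp0 : 0 ≤ p := hr0.trans hrp
  -- The defect from the tangent line is an exact multiple of (x - 1)². Its last factor is
  -- nonnegative because r ≤ p, τ ≤ 1/16 and x ≥ 1/2, and it is at most x because p ≤ 1.
  have key : rate N τ p r x = rate N τ p r 1 + N * (τ * p - τ ^ 2 * r) * (x - 1) -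
      N * τ * (x - 1) ^ 2 / x ^ 2 * (p * x - τ * r * (1 + 2 * x) / 2) := by
    unfold rate; field_simp; ring
  have hpos : 0 ≤ p * x - τ * r * (1 + 2 * x) / 2 := by
    have h1 : τ * r * (1 + 2 * x) / 2 ≤ τ * r * (4 * x) / 2 := by gcongr; linarith
    have h2 : τ * r ≤ 1 / 16 * p := by gcongr
    nlinarith
  have hfac : 0 ≤ N * τ * (x - 1) ^ 2 / x ^ 2 := by positivity
  rw [key]
  constructor
  · nlinarith [mul_nonneg hfac hpos]
  · have h1 : p * x - τ * r * (1 + 2 * x) / 2 ≤ x := by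
      have : 0 ≤ τ * r * (1 + 2 * x) / 2 := by positivity
      nlinarith
    have h2 : N * τ * (x - 1) ^ 2 / x ^ 2 * (p * x - τ * r * (1 + 2 * x) / 2) ≤
        N * τ * (x - 1) ^ 2 / x ^ 2 * x := mul_le_mul_of_nonneg_left h1 hfac
    have h3 : N * τ * (x - 1) ^ 2 / x ^ 2 * x ≤ 2 * N * τ * (x - 1) ^ 2 := by
      have : N * τ * (x - 1) ^ 2 / x ^ 2 * x = N * τ * (x - 1) ^ 2 * (1 / x) := by field_simp
      rw [this]
      have h4 : 1 / x ≤ 2 := by rw [div_le_iff₀ hx0]; linarith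
      have h5 : 0 ≤ N * τ * (x - 1) ^ 2 := by positivity
      nlinarith
    linarith

end tilt

/-! ### The exponent of the tilted sum. -/

lemma inv_exp_sub_one_bounds {x : ℝ} (h0 : 0 < x) (h1 : x ≤ 1) :
    |1 / (Real.exp x - 1) - 1 / x + 1 / 2| ≤ x := by
  have hlow := Real.quadratic_le_exp_of_nonneg h0.le
  have hup : Real.exp x - 1 ≤ x + x ^ 2 / 2 + x ^ 3 / 4 := by
    have h := Real.exp_bound' h0.le h1 (n := 3) (by norm_num)
    simp [Finset.sum_range_succ, Nat.factorial] at h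
    have : 0 ≤ x ^ 3 := by positivity
    linarith
  have hpos : 0 < Real.exp x - 1 := by nlinarith
  have hA : 1 / (Real.exp x - 1) ≤ 1 / x - 1 / 2 + x := by
    rw [div_le_iff₀ hpos]
    have : 0 ≤ 1 / x - 1 / 2 + x := by
      have : 1 ≤ 1 / x := by rw [one_le_div h0]; exact h1
      linarith
    refine le_trans ?_ (mul_le_mul_of_nonneg_left (show x + x ^ 2 / 2 ≤ _ by linarith) this)
    have e : (1 / x - 1 / 2 + x) * (x + x ^ 2 / 2) = 1 + (3 / 4) * x ^ 2 + x ^ 3 / 2 := by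
      field_simp; ring
    rw [e]; nlinarith [sq_nonneg x, pow_pos h0 3]
  have hB : 1 / x - 1 / 2 - x ≤ 1 / (Real.exp x - 1) := by
    have h2 : 1 / (x + x ^ 2 / 2 + x ^ 3 / 4) ≤ 1 / (Real.exp x - 1) :=
      one_div_le_one_div_of_le hpos hup
    refine le_trans ?_ h2
    rw [le_div_iff₀ (by positivity)]
    have e : (1 / x - 1 / 2 - x) * (x + x ^ 2 / 2 + x ^ 3 / 4) =
        1 - x ^ 2 - (5 / 8) * x ^ 3 - x ^ 4 / 4 := by
      field_simp; ring
    rw [e]; nlinarith [sq_nonneg x, pow_pos h0 3, pow_pos h0 4]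
  rw [abs_le]; constructor <;> linarith

/-- Mean value inequality for log(1 - exp(-x)) - log x + x/2, whose derivative is at most x in
absolute value by `inv_exp_sub_one_bounds`. -/
lemma log_one_sub_exp_neg_diff {τ θ : ℝ} (hθ : 0 < θ) (hθτ : θ ≤ τ) (hτ : τ ≤ 1) :
    |Real.log (1 - Real.exp (-τ)) - Real.log (1 - Real.exp (-θ)) -
      (Real.log τ - Real.log θ - (τ - θ) / 2)| ≤ τ * (τ - θ) := by
  let q : ℝ → ℝ := fun x => Real.log (1 - Real.exp (-x)) - Real.log x + x / 2
  have hderiv : ∀ x ∈ Set.Icc θ τ,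
      HasDerivWithinAt q (1 / (Real.exp x - 1) - 1 / x + 1 / 2) (Set.Icc θ τ) x := by
    intro x hx
    have hx0 : 0 < x := hθ.trans_le hx.1
    have he : 0 < 1 - Real.exp (-x) := by
      have : Real.exp (-x) < 1 := by rw [Real.exp_lt_one_iff]; linarith
      linarith
    have h1 : HasDerivAt (fun x => Real.exp (-x)) (Real.exp (-x) * (-1)) x :=
      (hasDerivAt_neg x).exp
    have h2 := ((h1.const_sub 1).log he.ne').sub (Real.hasDerivAt_log hx0.ne')
    have h3 := (h2.add ((hasDerivAt_id x).div_const 2)).hasDerivWithinAt (s := Set.Icc θ τ)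
    refine h3.congr_deriv ?_
    have hex : Real.exp x - 1 ≠ 0 := by
      have : 1 < Real.exp x := by rw [Real.one_lt_exp_iff]; exact hx0
      linarith
    rw [Real.exp_neg] at he ⊢
    have hep := Real.exp_pos x
    have : 1 - (Real.exp x)⁻¹ = (Real.exp x - 1) / Real.exp x := by field_simp
    rw [this]
    field_simp
  have h := (convex_Icc θ τ).norm_image_sub_le_of_norm_hasDerivWithin_le (C := τ) hderiv
    (fun x hx => by
      rw [Real.norm_eq_abs]
      exact (inv_exp_sub_one_bounds (hθ.trans_le hx.1) (hx.2.trans hτ)).trans hx.2)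
    (Set.left_mem_Icc.2 hθτ) (Set.right_mem_Icc.2 hθτ)
  rw [Real.norm_eq_abs, Real.norm_eq_abs, abs_of_nonneg (sub_nonneg.2 hθτ)] at h
  convert h using 2
  simp only [q]; ring

lemma tilt_bounds {τ p r : ℝ} (hτ : 0 < τ) (hτ1 : τ ≤ 1 / 16) (hr0 : 0 ≤ r) (hrp : r ≤ p)
    (hp : p ≤ 1) : 0 ≤ τ * p - τ ^ 2 * r ∧ τ * p - τ ^ 2 * r ≤ τ := by
  have hp0 : 0 ≤ p := hr0.trans hrp
  have hsq : τ ^ 2 ≤ 1 / 16 * τ := by rw [sq]; gcongr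
  constructor
  · have : τ ^ 2 * r ≤ 1 / 16 * τ * p := by gcongr
    have : 0 ≤ τ * p := by positivity
    linarith
  · have h1 : τ * p ≤ τ * 1 := by gcongr
    have h2 : 0 ≤ τ ^ 2 * r := by positivity
    linarith

lemma weight_mul_exp (n k : ℕ) (a b : ℝ) :
    weight n (Real.exp (-a)) k * Real.exp (((k + 1 : ℕ) : ℝ) * b) =
      weight n (Real.exp (-(a - b))) k := by
  rw [Real.exp_nat_mul, weight, weight, mul_right_comm, ← mul_pow, ← Real.exp_add]
  congr 3; ring

/-- With β = τp - τ²r, the difference of logarithms is β + β²/2 - τβ/2 up to O(τ³). The terms Nτp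
and Nβ cancel. What survives is Nτ²r/2 from `rate`, Nβ²/2 ≈ Sp²/2 and -Nτβ/2 ≈ -Sp/2. -/
lemma log_main_term {N τ p r S θ : ℝ} (hN : 1 ≤ N) (hτ : 0 < τ) (hτ1 : τ ≤ 1 / 16) (hr0 : 0 ≤ r)
    (hrp : r ≤ p) (hp : p ≤ 1) (hS : N * τ ^ 2 = S) (hθ : θ = τ * (1 - (τ * p - τ ^ 2 * r))) :
    |τ / 2 + N * τ * p + rate N τ p r 1 - N * (τ * p - τ ^ 2 * r) - θ +
        (N + 1) * (Real.log (1 - Real.exp (-τ)) - Real.log (1 - Real.exp (-θ))) -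
      S * (r / 2 + p ^ 2 / 2 - p / 2)| ≤ (6 + 5 * S) * τ := by
  have hp0 : 0 ≤ p := hr0.trans hrp
  have hsq : τ ^ 2 ≤ 1 / 16 * τ := by rw [sq]; gcongr
  obtain ⟨hβ0, hβτ⟩ := tilt_bounds hτ hτ1 hr0 hrp hp
  set β := τ * p - τ ^ 2 * r with hβ
  have hθ0 : 0 < θ := by rw [hθ]; apply mul_pos hτ; linarith
  have hθτ : θ ≤ τ := by rw [hθ]; nlinarith
  have hq := log_one_sub_exp_neg_diff hθ0 hθτ (by linarith)
  have hl := abs_log_one_add_sub_le (x := -β) (by rw [abs_neg, abs_of_nonneg hβ0]; linarith)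
  rw [abs_neg, abs_of_nonneg hβ0] at hl
  have hlog : Real.log θ = Real.log τ + Real.log (1 + -β) := by
    rw [hθ, Real.log_mul hτ.ne' (by linarith), sub_eq_add_neg]
  generalize Real.log (1 - Real.exp (-τ)) - Real.log (1 - Real.exp (-θ)) = Δ at hq ⊢
  rw [hlog] at hq
  generalize Real.log (1 + -β) = l at hl hq
  have hτθ : τ - θ = τ * β := by rw [hθ]; ring
  rw [hτθ] at hq
  obtain ⟨E, hE⟩ : ∃ E, Δ = β + β ^ 2 / 2 - τ * β / 2 + E :=
    ⟨Δ - (β + β ^ 2 / 2 - τ * β / 2), by ring⟩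
  have hβ3 : β ^ 3 ≤ τ ^ 3 := by gcongr
  have hττ : τ * (τ * β) ≤ τ ^ 3 := by
    have : τ * (τ * β) ≤ τ * (τ * τ) := by gcongr
    linarith
  have hEb : |E| ≤ 3 * τ ^ 3 := by
    rw [abs_le] at hq hl ⊢
    constructor <;> linarith [hq.1, hq.2, hl.1, hl.2]
  have hNE : |(N + 1) * E| ≤ 3 * S * τ + 3 * τ ^ 3 := by
    rw [abs_mul, abs_of_pos (by linarith : 0 < N + 1)]
    calc (N + 1) * |E| ≤ (N + 1) * (3 * τ ^ 3) := by gcongr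
      _ = 3 * (N * τ ^ 2) * τ + 3 * τ ^ 3 := by ring
      _ = _ := by rw [hS]
  have hS0 : 0 ≤ S := by rw [← hS]; positivity
  have hexp : τ / 2 + N * τ * p + rate N τ p r 1 - N * β - θ + (N + 1) * Δ -
      S * (r / 2 + p ^ 2 / 2 - p / 2) =
      S * (τ * r * (τ * r - 2 * p) / 2 + τ * r / 2) +
        (τ / 2 - θ + β + β ^ 2 / 2 - τ * β / 2) + (N + 1) * E := by
    rw [hE, rate, ← hS, hβ]; ring
  rw [hexp]
  have hr1 : r ≤ 1 := hrp.trans hp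
  have h1 : |τ * r * (τ * r - 2 * p) / 2 + τ * r / 2| ≤ 2 * τ := by
    have a1 : 0 ≤ τ * r := by positivity
    have a2 : τ * r ≤ τ := by nlinarith
    have a3 : |τ * r - 2 * p + 1| ≤ 4 := by rw [abs_le]; constructor <;> linarith
    have a4 : τ * r * (τ * r - 2 * p) / 2 + τ * r / 2 = τ * r * (τ * r - 2 * p + 1) / 2 := by ring
    rw [a4, abs_div, abs_mul, abs_of_nonneg a1, abs_two]
    have := mul_le_mul a2 a3 (abs_nonneg _) hτ.le
    linarith
  have h2 : |S * (τ * r * (τ * r - 2 * p) / 2 + τ * r / 2)| ≤ 2 * S * τ := by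
    rw [abs_mul, abs_of_nonneg hS0]
    have := mul_le_mul_of_nonneg_left h1 hS0
    linarith
  have h3 : |τ / 2 - θ + β + β ^ 2 / 2 - τ * β / 2| ≤ 3 * τ := by
    have b1 : β ^ 2 ≤ τ ^ 2 := by gcongr
    have b2 : τ * β ≤ τ ^ 2 := by rw [sq]; gcongr
    have b3 : 0 ≤ τ * β := by positivity
    rw [abs_le]; constructor <;> linarith [sq_nonneg β]
  have hτ3 : τ ^ 3 ≤ τ := by
    calc τ ^ 3 = τ ^ 2 * τ := by ring
      _ ≤ 1 * τ := by gcongr; linarith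
      _ = τ := one_mul τ
  rw [abs_le] at h2 h3 hNE ⊢
  constructor <;> linarith [h2.1, h2.2, h3.1, h3.2, hNE.1, hNE.2]

/-- The essential ratio is exp(1/2)/(1 + t) per point, with t close to 1, and exp(1/2) < 2. The
decay is geometric, but Bernoulli's inequality keeps only the O(1/N) that is needed. -/
lemma tail_term_le {n : ℕ} {τ p N : ℝ} (hN : N = ((n + 1 : ℕ) : ℝ)) (hτ : 0 < τ) (hτ1 : τ ≤ 1 / 16)
    (hp : p ≤ 1) :
    Real.exp (τ / 2 + N * τ * p) * ((1 - Real.exp (-τ)) ^ (n + 2) * (Real.exp (N / 2) *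
      (Real.exp (-τ) ^ 2 / (1 - Real.exp (-τ) ^ 2) ^ (n + 2)))) ≤ 20 / N := by
  set t := Real.exp (-τ) with ht
  have hN1 : 0 < N := by rw [hN]; positivity
  have ht0 : 0 < t := Real.exp_pos _
  have ht1 : t < 1 := by rw [ht, Real.exp_lt_one_iff]; linarith
  have htlow : 15 / 16 ≤ t := by have := Real.add_one_le_exp (-τ); rw [← ht] at this; linarith
  have hfac : (1 - t) ^ (n + 2) * (Real.exp (N / 2) * (t ^ 2 / (1 - t ^ 2) ^ (n + 2))) =
      Real.exp (N / 2) * t ^ 2 * (1 / (1 + t)) ^ (n + 2) := by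
    have h1 : (1 - t ^ 2) = (1 - t) * (1 + t) := by ring
    have h2 : (1 - t) ≠ 0 := by linarith
    rw [h1, mul_pow, one_div, inv_pow]
    field_simp
  have hexp : Real.exp (9 / 16) ≤ 19 / 20 * (31 / 16) := by
    have h1 : Real.exp (9 / 16) ^ 2 = Real.exp 1 * Real.exp (1 / 8) := by
      rw [← Real.exp_nat_mul, ← Real.exp_add]; norm_num
    have h2 : Real.exp (1 / 8) ≤ 8 / 7 := by
      have := Real.add_one_le_exp (-(1 / 8 : ℝ))
      rw [Real.exp_neg, le_inv_comm₀ (by norm_num) (Real.exp_pos _)] at this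
      refine this.trans (by norm_num)
    have h3 := Real.exp_one_lt_d9
    have h4 : Real.exp (9 / 16) ^ 2 ≤ (19 / 20 * (31 / 16)) ^ 2 := by
      rw [h1]
      calc Real.exp 1 * Real.exp (1 / 8) ≤ 2.7182818286 * (8 / 7) := by gcongr
        _ ≤ _ := by norm_num
    exact (sq_le_sq₀ (Real.exp_pos _).le (by norm_num)).1 h4
  have hq : Real.exp (9 / 16) * (1 / (1 + t)) ≤ 19 / 20 := by
    rw [mul_one_div, div_le_iff₀ (by linarith)]
    refine hexp.trans ?_
    gcongr
    linarith
  have hn2 : ((n + 2 : ℕ) : ℝ) = N + 1 := by rw [hN]; push_cast; ring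
  have hpow : Real.exp (τ / 2 + N * τ * p) * Real.exp (N / 2) ≤ Real.exp (9 / 16) ^ (n + 2) := by
    rw [← Real.exp_add, ← Real.exp_nat_mul, hn2]
    apply Real.exp_le_exp.2
    have h1 : N * τ * p ≤ N * τ * 1 := by gcongr
    have h2 : N * τ ≤ N * (1 / 16) := by gcongr
    linarith
  have hbern : (20 / 19 : ℝ) ^ (n + 2) ≥ N / 20 := by
    have := one_add_mul_le_pow (a := (1 / 19 : ℝ)) (by norm_num) (n + 2)
    rw [hn2] at this
    have e : (1 + 1 / 19 : ℝ) = 20 / 19 := by norm_num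
    rw [e] at this
    linarith
  rw [hfac]
  calc Real.exp (τ / 2 + N * τ * p) * (Real.exp (N / 2) * t ^ 2 * (1 / (1 + t)) ^ (n + 2))
      = (Real.exp (τ / 2 + N * τ * p) * Real.exp (N / 2)) * (1 / (1 + t)) ^ (n + 2) * t ^ 2 := by
        ring
    _ ≤ Real.exp (9 / 16) ^ (n + 2) * (1 / (1 + t)) ^ (n + 2) * 1 := by
        gcongr
        exact pow_le_one₀ ht0.le ht1.le
    _ = (Real.exp (9 / 16) * (1 / (1 + t))) ^ (n + 2) := by rw [mul_one, mul_pow]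
    _ ≤ (19 / 20 : ℝ) ^ (n + 2) := by gcongr
    _ ≤ (19 / 20 : ℝ) ^ (n + 2) * ((20 / 19 : ℝ) ^ (n + 2) / (N / 20)) := by
        refine le_mul_of_one_le_right (by positivity) ?_
        rw [one_le_div (by positivity)]; exact hbern
    _ = 20 / N := by
        rw [← mul_div_assoc, ← mul_pow]; norm_num

set_option maxHeartbeats 800000 in
/-- Two-sided estimate of a negative binomial average of a function close to `exp (rate ·)`. -/
theorem weighted_sum_bounds {n : ℕ} {N τ p r C : ℝ} (ρ : ℕ → ℝ) (hN : N = ((n + 1 : ℕ) : ℝ))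
    (hτ : 0 < τ) (hτ1 : τ ≤ 1 / 16) (hr0 : 0 ≤ r) (hrp : r ≤ p) (hp : p ≤ 1)
    (hρ0 : ∀ k, 0 ≤ ρ k) (hρ1 : ∀ k, ρ k ≤ 1)
    (hlow : ∀ k : ℕ, 1 / 2 ≤ ((k + 1 : ℕ) : ℝ) * τ / N →
      Real.exp (rate N τ p r (((k + 1 : ℕ) : ℝ) * τ / N) - C * τ) ≤ ρ k)
    (hup : ∀ k : ℕ, 1 / 2 ≤ ((k + 1 : ℕ) : ℝ) * τ / N →
      ρ k ≤ Real.exp (rate N τ p r (((k + 1 : ℕ) : ℝ) * τ / N) + C * τ))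
    {θ Z : ℝ} (hθ : θ = τ * (1 - (τ * p - τ ^ 2 * r)))
    (hZ : Z = Real.exp (rate N τ p r 1 - N * (τ * p - τ ^ 2 * r)) *
      (Real.exp (-θ) / (1 - Real.exp (-θ)) ^ (n + 2))) :
    Real.exp (-(C * τ)) * Z * (1 - (2 * N * τ + 4) * (18 * τ ^ 2 + 12 / N)) ≤
        ∑' k, weight n (Real.exp (-τ)) k * ρ k ∧
      ∑' k, weight n (Real.exp (-τ)) k * ρ k ≤ Real.exp (C * τ) * Z + Real.exp (N / 2) *
        (Real.exp (-τ) ^ 2 / (1 - Real.exp (-τ) ^ 2) ^ (n + 2)) := by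
  have hN0 : 0 < N := by rw [hN]; positivity
  have hN1 : 1 ≤ N := by rw [hN]; push_cast; linarith [Nat.cast_nonneg (α := ℝ) n]
  obtain ⟨hβ0, hβτ⟩ := tilt_bounds hτ hτ1 hr0 hrp hp
  set β := τ * p - τ ^ 2 * r with hβ
  have hθ0 : 0 < θ := by rw [hθ]; apply mul_pos hτ; linarith
  set t := Real.exp (-τ) with ht
  set t' := Real.exp (-θ) with ht'
  have ht0 : 0 ≤ t := (Real.exp_pos _).le
  have ht1 : t < 1 := by rw [ht, Real.exp_lt_one_iff]; linarith
  have ht0' : 0 ≤ t' := (Real.exp_pos _).le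
  have ht1' : t' < 1 := by rw [ht', Real.exp_lt_one_iff]; linarith
  have ht2 : t ^ 2 < 1 := pow_lt_one₀ ht0 ht1 two_ne_zero
  let x : ℕ → ℝ := fun k => ((k + 1 : ℕ) : ℝ) * τ / N
  have hNx : ∀ k, N * x k = ((k + 1 : ℕ) : ℝ) * τ := fun k => by
    simp only [x]; field_simp
  have htilt : ∀ k, weight n t k * Real.exp (N * β * x k) = weight n t' k := fun k => by
    rw [show N * β * x k = ((k + 1 : ℕ) : ℝ) * (β * τ) by linear_combination β * hNx k, ht,
      weight_mul_exp, ht', hθ]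
    congr 2; ring
  have hw2 : ∀ k, weight n t k * Real.exp (-(N * x k)) = weight n (t ^ 2) k := fun k => by
    rw [show -(N * x k) = ((k + 1 : ℕ) : ℝ) * (-τ) by rw [hNx]; ring, ht, weight_mul_exp,
      ← Real.exp_nat_mul]
    congr 2; push_cast; ring
  have hw0 : ∀ k, 0 ≤ weight n t k := weight_nonneg n ht0
  have hw0' : ∀ k, 0 ≤ weight n t' k := weight_nonneg n ht0'
  have hw2' : ∀ k, 0 ≤ weight n (t ^ 2) k := weight_nonneg n (by positivity)
  set F := Real.exp (rate N τ p r 1 - N * β) with hF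
  have hF0 : 0 < F := Real.exp_pos _
  have hupper : ∀ k, weight n t k * ρ k ≤
      Real.exp (C * τ) * F * weight n t' k + Real.exp (N / 2) * weight n (t ^ 2) k := fun k => by
    by_cases hx : 1 / 2 ≤ x k
    · have h1 := (rate_tangent hN0 hτ hτ1 hr0 hrp hp hx).1
      have h2 : ρ k ≤ Real.exp (C * τ) * F * Real.exp (N * β * x k) := by
        refine (hup k hx).trans ?_
        rw [hF, ← Real.exp_add, ← Real.exp_add]
        apply Real.exp_le_exp.2
        simp only [x] at h1 ⊢
        linarith
      calc weight n t k * ρ k ≤ weight n t k * (Real.exp (C * τ) * F * Real.exp (N * β * x k)) :=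
            mul_le_mul_of_nonneg_left h2 (hw0 k)
        _ = Real.exp (C * τ) * F * weight n t' k := by rw [← htilt]; ring
        _ ≤ _ := le_add_of_nonneg_right (mul_nonneg (Real.exp_pos _).le (hw2' k))
    -- Exponential bound for x < 1/2: the factor exp(-Nx) replaces the parameter t by t².
    · have h2 : ρ k ≤ Real.exp (N / 2) * Real.exp (-(N * x k)) := by
        refine (hρ1 k).trans ?_
        rw [← Real.exp_add]
        apply Real.one_le_exp
        nlinarith [not_le.1 hx]
      calc weight n t k * ρ k ≤ weight n t k * (Real.exp (N / 2) * Real.exp (-(N * x k))) :=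
            mul_le_mul_of_nonneg_left h2 (hw0 k)
        _ = Real.exp (N / 2) * weight n (t ^ 2) k := by rw [← hw2]; ring
        _ ≤ _ := le_add_of_nonneg_left (mul_nonneg (by positivity) (hw0' k))
  have hlower : ∀ k, Real.exp (-(C * τ)) * F * (weight n t' k -
      (2 * N * τ + 4) / (N / τ) ^ 2 * (weight n t' k * (((k + 1 : ℕ) : ℝ) - N / τ) ^ 2)) ≤
      weight n t k * ρ k := fun k => by
    have hxx : (((k + 1 : ℕ) : ℝ) - N / τ) ^ 2 = (N / τ) ^ 2 * (x k - 1) ^ 2 := by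
      simp only [x]; field_simp
    have hre : weight n t' k -
        (2 * N * τ + 4) / (N / τ) ^ 2 * (weight n t' k * (((k + 1 : ℕ) : ℝ) - N / τ) ^ 2) =
        weight n t' k * (1 - (2 * N * τ + 4) * (x k - 1) ^ 2) := by
      rw [hxx]; field_simp
    rw [hre]
    by_cases hx : 1 / 2 ≤ x k
    · have h1 := (rate_tangent hN0 hτ hτ1 hr0 hrp hp hx).2
      have h3 := Real.add_one_le_exp (-(2 * N * τ * (x k - 1) ^ 2))
      have h2 : Real.exp (-(C * τ)) * F * Real.exp (N * β * x k) *
          (1 - (2 * N * τ + 4) * (x k - 1) ^ 2) ≤ ρ k := by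
        refine le_trans ?_ (hlow k hx)
        calc Real.exp (-(C * τ)) * F * Real.exp (N * β * x k) *
              (1 - (2 * N * τ + 4) * (x k - 1) ^ 2)
            ≤ Real.exp (-(C * τ)) * F * Real.exp (N * β * x k) *
              Real.exp (-(2 * N * τ * (x k - 1) ^ 2)) := by
              refine mul_le_mul_of_nonneg_left ?_ (by positivity)
              nlinarith [sq_nonneg (x k - 1)]
          _ ≤ _ := by
              rw [hF, ← Real.exp_add, ← Real.exp_add, ← Real.exp_add]
              apply Real.exp_le_exp.2
              simp only [x] at h1 ⊢
              linarith
      calc Real.exp (-(C * τ)) * F * (weight n t' k * (1 - (2 * N * τ + 4) * (x k - 1) ^ 2))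
          = weight n t k * (Real.exp (-(C * τ)) * F * Real.exp (N * β * x k) *
              (1 - (2 * N * τ + 4) * (x k - 1) ^ 2)) := by rw [← htilt]; ring
        _ ≤ _ := mul_le_mul_of_nonneg_left h2 (hw0 k)
    · refine le_trans ?_ (mul_nonneg (hw0 k) (hρ0 k))
      -- The summand 4 in the coefficient makes the minorant nonpositive as soon as |x - 1| ≥ 1/2,
      -- so the region x < 1/2 needs no lower bound on ρ.
      have h1 : 1 - (2 * N * τ + 4) * (x k - 1) ^ 2 ≤ 0 := by
        have h2 : 1 / 4 ≤ (x k - 1) ^ 2 := by nlinarith [not_le.1 hx]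
        have h3 : 0 ≤ N * τ := by positivity
        nlinarith
      exact mul_nonpos_of_nonneg_of_nonpos (by positivity)
        (mul_nonpos_of_nonneg_of_nonpos (hw0' k) h1)
  have hs1 := hasSum_weight n ht0 ht1
  have hs2 := hasSum_weight n ht0' ht1'
  have hs3 := hasSum_weight n (t := t ^ 2) (by positivity) ht2
  have hs4 := hasSum_weight_mul_sq n ht0' ht1' (N / τ)
  have hsummable : Summable fun k => weight n t k * ρ k :=
    Summable.of_nonneg_of_le (fun k => mul_nonneg (hw0 k) (hρ0 k))
      (fun k => mul_le_of_le_one_right (hw0 k) (hρ1 k)) hs1.summable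
  constructor
  · have hsum := (hs2.sub (hs4.mul_left ((2 * N * τ + 4) / (N / τ) ^ 2))).mul_left
      (Real.exp (-(C * τ)) * F)
    have h := hasSum_le hlower hsum hsummable.hasSum
    refine le_trans ?_ h
    have hmom := second_moment_le (θ := θ) hN1 hτ hτ1 hβ0 hβτ hθ
    rw [← ht'] at hmom
    have hn2 : ((n + 2 : ℕ) : ℝ) = N + 1 := by rw [hN]; push_cast; ring
    rw [hn2, ← hN]
    set Y := t' / (1 - t') ^ (n + 2) with hY
    have hY0 : 0 ≤ Y := by
      have : 0 < 1 - t' := by linarith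
      positivity
    set Q := ((N + 1) / (1 - t') - (N + N / τ)) ^ 2 + (N + 1) / (1 - t') ^ 2 - (N + 1) / (1 - t')
    have e1 : Y - (2 * N * τ + 4) / (N / τ) ^ 2 * (Y * Q) =
        Y * (1 - (2 * N * τ + 4) * (Q / (N / τ) ^ 2)) := by ring
    rw [e1, hZ, ← mul_assoc, ← mul_assoc]
    refine mul_le_mul_of_nonneg_left ?_ (by positivity)
    have : 0 ≤ 2 * N * τ + 4 := by positivity
    nlinarith [mul_le_mul_of_nonneg_left hmom this]
  · have hsum := (hs2.mul_left (Real.exp (C * τ) * F)).add (hs3.mul_left (Real.exp (N / 2)))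
    have h := hasSum_le hupper hsummable.hasSum hsum
    rw [hZ, ← mul_assoc]
    exact h

/-! ### Assembly of the estimates and the final rate. -/

lemma combine_bounds {M G τ a D b C₂ : ℝ} (hτ : 0 < τ) (hτ1 : τ ≤ 1) (ha : 0 ≤ a) (hG : 0 < G)
    (hM : 0 ≤ M) (hD0 : 0 ≤ D) (hD : D ≤ C₂ * τ)
    (hlow : D ≤ 1 → Real.exp (-(a * τ)) * G * (1 - D) ≤ M)
    (hup : M ≤ Real.exp (a * τ) * G + b * τ) :
    |M - G| ≤ ((a * Real.exp a + a + C₂) * G + |b|) * τ := by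
  have haτ : 0 ≤ a * τ := by positivity
  have hC₂ : 0 ≤ C₂ := by
    by_contra h
    nlinarith [mul_pos_of_neg_of_neg (not_le.1 h) (neg_lt_zero.2 hτ)]
  have hexp : Real.exp (a * τ) - 1 ≤ a * τ * Real.exp a := by
    have h1 := Real.add_one_le_exp (-(a * τ))
    have h2 : Real.exp (a * τ) ≤ Real.exp a := by
      apply Real.exp_le_exp.2; nlinarith
    have h3 : Real.exp (a * τ) * Real.exp (-(a * τ)) = 1 := by rw [← Real.exp_add]; simp
    have h4 := mul_le_mul_of_nonneg_left h1 (Real.exp_pos (a * τ)).le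
    have h5 := mul_le_mul_of_nonneg_left h2 haτ
    linarith
  have hb : b * τ ≤ |b| * τ := mul_le_mul_of_nonneg_right (le_abs_self b) hτ.le
  have hb0 : 0 ≤ |b| * τ := by positivity
  rw [abs_le]
  constructor
  · have h0 : 0 ≤ a * Real.exp a * G * τ := by positivity
    suffices G - (a * τ + D) * G ≤ M by nlinarith [mul_le_mul_of_nonneg_right hD hG.le]
    by_cases hD1 : D ≤ 1
    · refine le_trans ?_ (hlow hD1)
      have h1 := Real.add_one_le_exp (-(a * τ))
      have h2 : Real.exp (-(a * τ)) ≤ 1 := by rw [Real.exp_le_one_iff]; linarith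
      have h3 : 1 - (a * τ + D) ≤ Real.exp (-(a * τ)) * (1 - D) := by nlinarith
      nlinarith [mul_le_mul_of_nonneg_right h3 hG.le]
    · have : (1 - (a * τ + D)) * G ≤ 0 :=
        mul_nonpos_of_nonpos_of_nonneg (by linarith [not_le.1 hD1]) hG.le
      linarith
  · have h0 : 0 ≤ (a + C₂) * G * τ := by positivity
    nlinarith [mul_le_mul_of_nonneg_right hexp hG.le]

lemma sgn_mul_bounds (e : Bool) {τ : ℝ} (hτ : 0 < τ) : -τ ≤ sgn e * τ ∧ sgn e * τ ≤ τ := by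
  cases e <;> simp [sgn] <;> linarith

/-- In the order-preserving case the middle inequality amounts to 0 ≤ (1 - α)²(1 + 2α). -/
lemma coefficient_bounds (e : Bool) {α : ℝ} (h0 : 0 ≤ α) (h1 : α ≤ 1) :
    0 ≤ (1 - α ^ 3) / 3 ∧ (1 - α ^ 3) / 3 ≤ (1 - sgn e * α ^ 2) / 2 ∧
      (1 - sgn e * α ^ 2) / 2 ≤ 1 := by
  have h2 : α ^ 2 ≤ 1 := pow_le_one₀ h0 h1
  have h3 : α ^ 3 ≤ 1 := pow_le_one₀ h0 h1
  have h4 : 0 ≤ α ^ 3 := by positivity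
  cases e with
  | true =>
    simp only [sgn, if_true]
    refine ⟨by linarith, ?_, by nlinarith⟩
    nlinarith [mul_nonneg (sub_nonneg.2 h1) (sub_nonneg.2 h1), mul_nonneg h0 (sub_nonneg.2 h1),
      mul_nonneg h0 (mul_nonneg (sub_nonneg.2 h1) (sub_nonneg.2 h1))]
  | false =>
    simp only [sgn, Bool.false_eq_true, if_false]
    refine ⟨by linarith, by nlinarith [sq_nonneg α], by linarith⟩

/-- The limiting moment generating function. -/
noncomputable def limitMGF (S α : ℝ) : ℝ := Real.exp (S / 24 * (1 - 4 * α ^ 3 + 3 * α ^ 4))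

lemma limitMGF_le {S α : ℝ} (hS : 0 ≤ S) (h0 : 0 ≤ α) (h1 : α ≤ 1) :
    limitMGF S α ≤ Real.exp S := by
  apply Real.exp_le_exp.2
  have h2 : 3 * α ^ 4 ≤ 4 * α ^ 3 := by
    have : α ^ 4 = α ^ 3 * α := by ring
    have h3 : 0 ≤ α ^ 3 := by positivity
    nlinarith
  nlinarith

/-- The error constant of `descentMGF_estimate`. -/
noncomputable def errorConstant (S : ℝ) : ℝ :=
  ((16 + 37 * S) * Real.exp (16 + 37 * S) + (16 + 37 * S) + (36 * S + 29 + 3 / S)) * Real.exp S +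
    60 / S

lemma fixedNumber_le {n : ℕ} (c : Equiv.Perm (Fin n)) : fixedNumber c ≤ n :=
  (Finset.card_le_univ _).trans_eq (Fintype.card_fin _)

lemma main_term_eq_exp {n : ℕ} {N τ θ A B : ℝ} (hN : N = ((n + 1 : ℕ) : ℝ)) (hτ : 0 < τ)
    (hθ : 0 < θ) :
    Real.exp A * ((1 - Real.exp (-τ)) ^ (n + 2) * (Real.exp B *
      (Real.exp (-θ) / (1 - Real.exp (-θ)) ^ (n + 2)))) =
      Real.exp (A + B - θ + (N + 1) * (Real.log (1 - Real.exp (-τ)) -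
        Real.log (1 - Real.exp (-θ)))) := by
  have hpos : ∀ {y : ℝ}, 0 < y → 0 < 1 - Real.exp (-y) := fun {y} hy => by
    have : Real.exp (-y) < 1 := by rw [Real.exp_lt_one_iff]; linarith
    linarith
  have hpow : ∀ {y : ℝ}, 0 < y → (1 - Real.exp (-y)) ^ (n + 2) =
      Real.exp ((N + 1) * Real.log (1 - Real.exp (-y))) := fun {y} hy => by
    have hn2 : N + 1 = ((n + 2 : ℕ) : ℝ) := by rw [hN]; push_cast; ring
    rw [hn2, Real.exp_nat_mul, Real.exp_log (hpos hy)]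
  rw [hpow hτ, hpow hθ, ← Real.exp_sub, ← Real.exp_add, ← Real.exp_add, ← Real.exp_add]
  congr 1; ring

set_option maxHeartbeats 800000 in
/-- The moment generating function at `±τ √n` is within `O(τ)` of its limit. -/
theorem descentMGF_estimate {n : ℕ} {lam : (n + 1).Partition} {c : Equiv.Perm (Fin (n + 1))}
    (hc : c ∈ conjClass lam) (e : Bool) {τ S : ℝ} (hτ : 0 < τ) (hτ1 : τ ≤ 1 / 16)
    (hS : ((n + 1 : ℕ) : ℝ) * τ ^ 2 = S) :
    |descentMGF lam (-(sgn e * (τ * Real.sqrt ((n + 1 : ℕ) : ℝ)))) -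
      limitMGF S (fixedRatio lam)| ≤ errorConstant S * τ := by
  rw [descentMGF_eq_tsum hc e hτ, fixedRatio, mult_one_eq_fixedNumber hc]
  obtain ⟨N, hN⟩ : ∃ N : ℝ, N = ((n + 1 : ℕ) : ℝ) := ⟨_, rfl⟩
  rw [← hN] at hS ⊢
  have hN0 : 0 < N := by rw [hN]; positivity
  have hN1 : 1 ≤ N := by rw [hN]; push_cast; linarith [Nat.cast_nonneg (α := ℝ) n]
  have hS0 : 0 < S := by rw [← hS]; positivity
  obtain ⟨α, hα⟩ : ∃ α : ℝ, α = fixedNumber c / N := ⟨_, rfl⟩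
  have hα0 : 0 ≤ α := by rw [hα]; positivity
  have hα1 : α ≤ 1 := by
    rw [hα, div_le_one hN0, hN]; exact_mod_cast fixedNumber_le c
  obtain ⟨hr0, hrp, hp⟩ := coefficient_bounds e hα0 hα1
  have hpref : τ * (N + 1) / 2 - sgn e * τ * (fixedNumber c : ℝ) ^ 2 / (2 * N) =
      τ / 2 + N * τ * ((1 - sgn e * α ^ 2) / 2) := by
    rw [hα]; field_simp; ring
  rw [hpref, ← hα]
  -- The α² terms of p²/2 and p/2 cancel and the sign enters only squared, so both orientations give
  -- the same limit.
  have hlimit : limitMGF S α = Real.exp (S * ((1 - α ^ 3) / 3 / 2 +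
      ((1 - sgn e * α ^ 2) / 2) ^ 2 / 2 - (1 - sgn e * α ^ 2) / 2 / 2)) := by
    rw [limitMGF]; congr 1
    linear_combination (-(S * α ^ 4 / 8)) * sgn_sq e
  have hbounds := fun (k : ℕ) (hx : 1 / 2 ≤ ((k + 1 : ℕ) : ℝ) * τ / N) =>
    compatibleRatio_bounds e c (Nat.succ_pos k) hτ hτ1 hN hα rfl hx
  rw [hS] at hbounds
  generalize (1 - sgn e * α ^ 2) / 2 = p at *
  generalize (1 - α ^ 3) / 3 = r at *
  obtain ⟨θ, hθ⟩ : ∃ θ, θ = τ * (1 - (τ * p - τ ^ 2 * r)) := ⟨_, rfl⟩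
  obtain ⟨Z, hZ⟩ : ∃ Z, Z = Real.exp (rate N τ p r 1 - N * (τ * p - τ ^ 2 * r)) *
      (Real.exp (-θ) / (1 - Real.exp (-θ)) ^ (n + 2)) := ⟨_, rfl⟩
  have hβ := tilt_bounds hτ hτ1 hr0 hrp hp
  have hθ0 : 0 < θ := by rw [hθ]; apply mul_pos hτ; linarith [hβ.2]
  obtain ⟨hl, hu⟩ := weighted_sum_bounds (C := 9 + 32 * S) (fun k => compatibleRatio e c (k + 1))
    hN hτ hτ1 hr0 hrp hp (fun k => compatibleRatio_nonneg e c _)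
    (fun k => compatibleRatio_le_one e c _) (fun k hx => (hbounds k hx).1)
    (fun k hx => (hbounds k hx).2) hθ hZ
  have hmain := log_main_term hN1 hτ hτ1 hr0 hrp hp hS hθ
  have hmaineq := main_term_eq_exp (A := τ / 2 + N * τ * p)
    (B := rate N τ p r 1 - N * (τ * p - τ ^ 2 * r)) hN hτ hθ0
  rw [← hZ] at hmaineq
  have htail := tail_term_le hN hτ hτ1 hp
  change |Real.exp (sgn e * τ) * (Real.exp (τ / 2 + N * τ * p) * ((1 - Real.exp (-τ)) ^ (n + 2) *
    ∑' k, weight n (Real.exp (-τ)) k * compatibleRatio e c (k + 1))) - _| ≤ _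
  generalize hT : ∑' k, weight n (Real.exp (-τ)) k * compatibleRatio e c (k + 1) = T at hl hu ⊢
  have hT0 : 0 ≤ T := by
    rw [← hT]
    exact tsum_nonneg fun k => mul_nonneg (weight_nonneg n (Real.exp_pos _).le k)
      (compatibleRatio_nonneg e c _)
  have hv0 : 0 < 1 - Real.exp (-τ) := by
    have : Real.exp (-τ) < 1 := by rw [Real.exp_lt_one_iff]; linarith
    linarith
  obtain ⟨P, hP⟩ : ∃ P, P = Real.exp (τ / 2 + N * τ * p) * (1 - Real.exp (-τ)) ^ (n + 2) :=
    ⟨_, rfl⟩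
  have hP0 : 0 < P := by rw [hP]; positivity
  rw [← mul_assoc, ← hP] at hmaineq htail
  rw [← mul_assoc (Real.exp (τ / 2 + N * τ * p)), ← hP]
  obtain ⟨ℓ, hℓ⟩ : ∃ ℓ, ℓ = τ / 2 + N * τ * p + (rate N τ p r 1 - N * (τ * p - τ ^ 2 * r)) - θ +
      (N + 1) * (Real.log (1 - Real.exp (-τ)) - Real.log (1 - Real.exp (-θ))) := ⟨_, rfl⟩
  rw [← hℓ] at hmaineq
  obtain ⟨L, hL⟩ : ∃ L, L = S * (r / 2 + p ^ 2 / 2 - p / 2) := ⟨_, rfl⟩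
  have hℓL : |ℓ - L| ≤ (6 + 5 * S) * τ := by
    rw [hℓ, hL]; convert hmain using 2; ring
  rw [abs_le] at hℓL
  rw [← hL] at hlimit
  have hs := sgn_mul_bounds e hτ
  -- This converts the 1/N errors into O(τ), at the price of a constant singular at S = 0.
  have hNinv : 1 / N = τ ^ 2 / S := by rw [← hS]; field_simp
  have hsq : τ ^ 2 ≤ 1 / 16 * τ := by rw [sq]; gcongr
  obtain ⟨D, hD⟩ : ∃ D, D = (2 * N * τ + 4) * (18 * τ ^ 2 + 12 / N) := ⟨_, rfl⟩
  rw [← hD] at hl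
  have hD0 : 0 ≤ D := by rw [hD]; positivity
  have hDle : D ≤ (36 * S + 29 + 3 / S) * τ := by
    have e1 : D = 36 * S * τ + 24 * τ + 72 * τ ^ 2 + 48 * (1 / N) := by
      rw [hD, ← hS]; field_simp; ring
    have e2 : 48 * (1 / N) ≤ 3 / S * τ := by
      rw [hNinv]
      calc 48 * (τ ^ 2 / S) = 48 / S * τ ^ 2 := by ring
        _ ≤ 48 / S * (1 / 16 * τ) := by gcongr
        _ = 3 / S * τ := by ring
    rw [e1]
    linarith
  have hest := combine_bounds (M := Real.exp (sgn e * τ) * (P * T)) (G := Real.exp L)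
    (a := 16 + 37 * S) (b := 60 / S) hτ (by linarith) (by positivity) (Real.exp_pos L)
    (by positivity) hD0 hDle ?_ ?_
  · rw [hlimit]
    refine hest.trans (mul_le_mul_of_nonneg_right ?_ hτ.le)
    rw [abs_of_pos (by positivity), errorConstant]
    have : Real.exp L ≤ Real.exp S := by rw [← hlimit]; exact limitMGF_le hS0.le hα0 hα1
    gcongr
  · intro hD1
    have h1D : 0 ≤ 1 - D := by linarith
    calc Real.exp (-((16 + 37 * S) * τ)) * Real.exp L * (1 - D)
        ≤ Real.exp (sgn e * τ) * Real.exp (-((9 + 32 * S) * τ)) * Real.exp ℓ * (1 - D) := by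
          refine mul_le_mul_of_nonneg_right ?_ h1D
          rw [← Real.exp_add, ← Real.exp_add, ← Real.exp_add]
          apply Real.exp_le_exp.2
          linarith [hs.1, hℓL.1]
      _ = Real.exp (sgn e * τ) * (P * (Real.exp (-((9 + 32 * S) * τ)) * Z * (1 - D))) := by
          rw [← hmaineq]; ring
      _ ≤ _ := by gcongr
  · have h3 : Real.exp (sgn e * τ) ≤ 3 := by
      calc Real.exp (sgn e * τ) ≤ Real.exp 1 := Real.exp_le_exp.2 (by linarith [hs.2])
        _ ≤ 3 := by linarith [Real.exp_one_lt_d9]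
    calc Real.exp (sgn e * τ) * (P * T)
        ≤ Real.exp (sgn e * τ) * (P * (Real.exp ((9 + 32 * S) * τ) * Z + Real.exp (N / 2) *
          (Real.exp (-τ) ^ 2 / (1 - Real.exp (-τ) ^ 2) ^ (n + 2)))) := by gcongr
      _ = Real.exp (sgn e * τ) * Real.exp ((9 + 32 * S) * τ) * Real.exp ℓ +
          Real.exp (sgn e * τ) * (P * (Real.exp (N / 2) *
            (Real.exp (-τ) ^ 2 / (1 - Real.exp (-τ) ^ 2) ^ (n + 2)))) := by
          rw [← hmaineq]; ring
      _ ≤ Real.exp ((16 + 37 * S) * τ) * Real.exp L + 60 / S * τ := by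
          refine add_le_add ?_ ?_
          · rw [← Real.exp_add, ← Real.exp_add, ← Real.exp_add]
            apply Real.exp_le_exp.2
            linarith [hs.2, hℓL.2]
          · refine (mul_le_mul h3 htail ?_ (by norm_num)).trans ?_
            · have : 0 < 1 - Real.exp (-τ) ^ 2 := sub_pos.2
                (pow_lt_one₀ (Real.exp_pos _).le (by linarith) two_ne_zero)
              positivity
            · have : 3 * (20 / N) = 60 / S * τ ^ 2 := by
                rw [show (20 : ℝ) / N = 20 * (1 / N) by ring, hNinv]; ring
              rw [this]
              gcongr
              linarith

lemma abs_normalizedDescent_le {n : ℕ} {lam : (n + 1).Partition} (π : Equiv.Perm (Fin (n + 1))) :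
    |normalizedDescent lam π| ≤ 2 * Real.sqrt ((n + 1 : ℕ) : ℝ) := by
  obtain ⟨c, hc⟩ := exists_mem_conjClass lam
  rw [normalizedDescent, mult_one_eq_fixedNumber hc]
  have hN : (0 : ℝ) < ((n + 1 : ℕ) : ℝ) := by positivity
  have hN1 : (1 : ℝ) ≤ ((n + 1 : ℕ) : ℝ) := by
    push_cast; linarith [Nat.cast_nonneg (α := ℝ) n]
  have hd : (descentNumber π : ℝ) ≤ ((n + 1 : ℕ) : ℝ) := by
    exact_mod_cast (descentNumber_le π).trans (Nat.le_succ n)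
  have hd0 : (0 : ℝ) ≤ descentNumber π := by positivity
  have hm : (fixedNumber c : ℝ) ≤ ((n + 1 : ℕ) : ℝ) := by exact_mod_cast fixedNumber_le c
  have hm2 : (fixedNumber c : ℝ) ^ 2 / (2 * ((n + 1 : ℕ) : ℝ)) ≤ ((n + 1 : ℕ) : ℝ) / 2 := by
    rw [div_le_iff₀ (by positivity)]
    have : (fixedNumber c : ℝ) ^ 2 ≤ ((n + 1 : ℕ) : ℝ) ^ 2 := by gcongr
    linarith
  have hm0 : 0 ≤ (fixedNumber c : ℝ) ^ 2 / (2 * ((n + 1 : ℕ) : ℝ)) := by positivity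
  rw [abs_div, abs_of_pos (Real.sqrt_pos.2 hN), div_le_iff₀ (Real.sqrt_pos.2 hN), mul_assoc,
    Real.mul_self_sqrt hN.le, abs_le]
  constructor <;> linarith

lemma descentMGF_bounds {n : ℕ} (lam : (n + 1).Partition) (s : ℝ) :
    0 ≤ descentMGF lam s ∧
      descentMGF lam s ≤ Real.exp (|s| * (2 * Real.sqrt ((n + 1 : ℕ) : ℝ))) := by
  have hcard : (0 : ℝ) < (conjClass lam).card := by
    exact_mod_cast Finset.card_pos.2 (exists_mem_conjClass lam)
  rw [descentMGF_eq_sum]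
  constructor
  · exact div_nonneg (Finset.sum_nonneg fun _ _ => (Real.exp_pos _).le) hcard.le
  · rw [div_le_iff₀ hcard, mul_comm, ← nsmul_eq_mul]
    refine Finset.sum_le_card_nsmul _ _ _ fun π _ => Real.exp_le_exp.2 ?_
    calc s * normalizedDescent lam π ≤ |s * normalizedDescent lam π| := le_abs_self _
      _ = |s| * |normalizedDescent lam π| := abs_mul _ _
      _ ≤ _ := by gcongr; exact abs_normalizedDescent_le π

lemma fixedRatio_bounds {n : ℕ} (lam : (n + 1).Partition) :
    0 ≤ fixedRatio lam ∧ fixedRatio lam ≤ 1 := by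
  obtain ⟨c, hc⟩ := exists_mem_conjClass lam
  rw [fixedRatio, mult_one_eq_fixedNumber hc]
  refine ⟨by positivity, ?_⟩
  rw [div_le_one (by positivity)]
  exact_mod_cast fixedNumber_le c

/-- The approximation of the moment generating function with rate `1 / √n`. -/
theorem descentMGF_rate (s : ℝ) : ∃ C : ℝ, 0 ≤ C ∧ ∀ (n : ℕ) (lam : (n + 1).Partition),
    |descentMGF lam s - limitMGF (s ^ 2) (fixedRatio lam)| ≤
      C / Real.sqrt ((n + 1 : ℕ) : ℝ) := by
  -- The case s = 0 is separate because `errorConstant` divides by S; there both functions equal 1.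
  rcases eq_or_ne s 0 with rfl | hs
  · refine ⟨0, le_rfl, fun n lam => ?_⟩
    have hcard : ((conjClass lam).card : ℝ) ≠ 0 := by
      exact_mod_cast (Finset.card_pos.2 (exists_mem_conjClass lam)).ne'
    simp [descentMGF_eq_sum, limitMGF, hcard]
  have hs2 : 0 < s ^ 2 := by positivity
  have hE : 0 ≤ errorConstant (s ^ 2) := by unfold errorConstant; positivity
  refine ⟨errorConstant (s ^ 2) * |s| + (Real.exp (|s| * (2 * (16 * |s|))) + Real.exp (s ^ 2)) *
    (16 * |s|), by positivity, fun n lam => ?_⟩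
  have hN : (0 : ℝ) < ((n + 1 : ℕ) : ℝ) := by positivity
  have hsqrt : 0 < Real.sqrt ((n + 1 : ℕ) : ℝ) := Real.sqrt_pos.2 hN
  obtain ⟨c, hc⟩ := exists_mem_conjClass lam
  obtain ⟨hα0, hα1⟩ := fixedRatio_bounds lam
  rw [le_div_iff₀ hsqrt]
  -- If τ = |s|/√N exceeds 1/16, then N is bounded in terms of s and crude bounds on both functions
  -- suffice.
  by_cases hlarge : |s| / Real.sqrt ((n + 1 : ℕ) : ℝ) ≤ 1 / 16
  · have hτ : 0 < |s| / Real.sqrt ((n + 1 : ℕ) : ℝ) := by positivity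
    have hS : ((n + 1 : ℕ) : ℝ) * (|s| / Real.sqrt ((n + 1 : ℕ) : ℝ)) ^ 2 = s ^ 2 := by
      rw [div_pow, Real.sq_sqrt hN.le, sq_abs]; field_simp
    -- The order-preserving count serves negative s and the order-reversing one positive s.
    have harg : -(sgn (decide (s < 0)) * (|s| / Real.sqrt ((n + 1 : ℕ) : ℝ) *
        Real.sqrt ((n + 1 : ℕ) : ℝ))) = s := by
      rw [div_mul_cancel₀ _ hsqrt.ne']
      by_cases h : s < 0
      · simp [sgn, h, abs_of_neg h]
      · simp [sgn, h, abs_of_nonneg (not_lt.1 h)]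
    have h := descentMGF_estimate hc (decide (s < 0)) hτ hlarge hS
    rw [harg] at h
    calc _ ≤ errorConstant (s ^ 2) * (|s| / Real.sqrt ((n + 1 : ℕ) : ℝ)) *
          Real.sqrt ((n + 1 : ℕ) : ℝ) := mul_le_mul_of_nonneg_right h hsqrt.le
      _ = errorConstant (s ^ 2) * |s| := by field_simp
      _ ≤ _ := le_add_of_nonneg_right (by positivity)
  · have hsmall : Real.sqrt ((n + 1 : ℕ) : ℝ) ≤ 16 * |s| := by
      rw [not_le, lt_div_iff₀ hsqrt] at hlarge
      linarith
    obtain ⟨hM0, hM1⟩ := descentMGF_bounds lam s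
    have hG := limitMGF_le hs2.le hα0 hα1
    have hG0 : 0 < limitMGF (s ^ 2) (fixedRatio lam) := Real.exp_pos _
    have hM2 : descentMGF lam s ≤ Real.exp (|s| * (2 * (16 * |s|))) :=
      hM1.trans (Real.exp_le_exp.2 (by gcongr))
    have h1 : |descentMGF lam s - limitMGF (s ^ 2) (fixedRatio lam)| ≤
        Real.exp (|s| * (2 * (16 * |s|))) + Real.exp (s ^ 2) := by
      rw [abs_le]
      constructor <;> linarith [Real.exp_pos (s ^ 2), Real.exp_pos (|s| * (2 * (16 * |s|)))]
    calc _ ≤ (Real.exp (|s| * (2 * (16 * |s|))) + Real.exp (s ^ 2)) * (16 * |s|) :=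
          mul_le_mul h1 hsmall hsqrt.le (by positivity)
      _ ≤ _ := le_add_of_nonneg_left (by positivity)

end ConjDescents

theorem theorem1p4 :
    ∃ C : ℝ → ℝ, (∀ s : ℝ, 0 < C s) ∧
      ∀ (n : ℕ), 2 ≤ n → ∀ (lam : n.Partition) (s : ℝ),
        |ConjDescents.descentMGF lam s -
            Real.exp (s ^ 2 / 24 *
              (1 - 4 * ConjDescents.fixedRatio lam ^ 3 + 3 * ConjDescents.fixedRatio lam ^ 4))|
          ≤ C s * (Real.log (n : ℝ) ^ 3 / Real.sqrt (n : ℝ)) := by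
  choose C hC0 hC using ConjDescents.descentMGF_rate
  have hlog2 : 0 < Real.log 2 := Real.log_pos (by norm_num)
  -- The logarithmic factor is slack: log n ≥ log 2 absorbs it into the constant, and the added 1
  -- makes the constant positive.
  refine ⟨fun s => (C s + 1) / Real.log 2 ^ 3, fun s => ?_, fun n hn lam s => ?_⟩
  · have := hC0 s
    positivity
  · obtain ⟨n, rfl⟩ : ∃ m, n = m + 1 := ⟨n - 1, by omega⟩
    have hCs := hC0 s
    have hn' : (2 : ℝ) ≤ ((n + 1 : ℕ) : ℝ) := by exact_mod_cast hn
    have hlog : Real.log 2 ≤ Real.log ((n + 1 : ℕ) : ℝ) := Real.log_le_log (by norm_num) hn'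
    have hsqrt : 0 < Real.sqrt ((n + 1 : ℕ) : ℝ) := Real.sqrt_pos.2 (by linarith)
    refine (hC s n lam).trans ?_
    rw [← mul_div_assoc]
    refine div_le_div_of_nonneg_right ?_ hsqrt.le
    rw [div_mul_eq_mul_div, le_div_iff₀ (by positivity)]
    exact mul_le_mul (by linarith) (by gcongr) (by positivity) (by linarith)
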